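/- Let $\mathbb{F}_q$ be a finite field with $q$ elements, of odd characteristic, let $m\ge 1$, $n=2m$, and let $S_m=\mathbb{F}_q[y_1,\ldots,y_m,x_m,\ldots,x_1]$ be the polynomial ring in $n$ variables. Let $\mathrm{GL}_n(\mathbb{F}_q)$ act on $S_m$ from the right by algebra automorphisms, where a linear form is identified with the row vector of its coefficients with respect to the ordered basis $y_1,\ldots,y_m,x_m,\ldots,x_1$ and a matrix acts on it by right multiplication. Put $$\xi_0=\sum_{k=1}^m y_kx_k,\qquad \xi_i=\sum_{k=1}^m\left(y_k^{q^i}x_k+y_kx_k^{q^i}\right)\quad(i>0),$$ let $G_m=\mathrm{O}^+_{2m}(\mathbb{F}_q)=\{g\in\mathrm{GL}_n(\mathbb{F}_q)\mid \xi_0\cdot g=\xi_0\}$, and let $S_m^{G_m}$ be its ring of invariants. Let $P_m$ be the subgroup of upper triangular unipotent matrices in $G_m$. For a linear form $v$ let $N(v)$ be the product of the distinct elements of the $P_m$-orbit of $v$, and let $$u_m=\prod_{i=1}^m N(y_i)N(x_i).$$ Let $\mathcal{P}(t):S_m\to S_m[t]$ be the algebra homomorphism with $\mathcal{P}(t)(v)=v+v^qt$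 for every linear form $v$, and write $\mathcal{P}(t)(f)=\sum_{k\ge 0}\mathcal{P}^k(f)t^k$. Then $u_m$ divides $\mathcal{P}^k(u_m)$ in $S_m$ for all $k$. For $1\le i\le m$ put $e(i,m)=\sum_{j=1}^i q^{n-1-j}$ and define $d_{i,m}\in S_m$ by $$u_m\,d_{i,m}=\mathcal{P}^{e(i,m)}(u_m).$$ Theorem. The set $\mathcal{H}=\{\xi_0,\ldots,\xi_{m-1},d_{1,m},\ldots,d_{m,m}\}$ is a homogeneous system of parameters for $S_m^{G_m}$. That is, its $2m$ members are homogeneous elements of $S_m^{G_m}$ of positive degree, they are algebraically independent over $\mathbb{F}_q$, and $S_m^{G_m}$ is a finitely generated module over $\mathbb{F}_q[\mathcal{H}]$. -/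

import Mathlib

namespace OrthInv

open MvPolynomial

/-- The polynomial ring `F[y_1, …, y_m, x_m, …, x_1]`. The variable `y_{i+1}` is `X (Sum.inl i)`
and `x_{i+1}` is `X (Sum.inr i)`, for `i : Fin m`. -/
abbrev S (m : ℕ) (F : Type*) [Field F] : Type _ := MvPolynomial (Fin m ⊕ Fin m) F

section Defs

variable (m : ℕ) (F : Type*) [Field F]

/-- The variable `y_{i+1}`. -/
noncomputable def y (i : Fin m) : S m F := X (Sum.inl i)

/-- The variable `x_{i+1}`. -/
noncomputable def x (i : Fin m) : S m F := X (Sum.inr i)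

variable {m F}

/-- The right action `f ↦ f · g` of the general linear group on the polynomial ring, by algebra
endomorphisms: a linear form is a row vector, and `g` acts on it by right multiplication, so the
`i`-th variable is sent to the linear form given by the `i`-th row of `g`. -/
noncomputable def act (g : GL (Fin m ⊕ Fin m) F) : S m F →ₐ[F] S m F :=
  aeval fun i => ∑ j, C (g.1 i j) * X j

theorem act_X (g : GL (Fin m ⊕ Fin m) F) (i : Fin m ⊕ Fin m) :
    act g (X i : S m F) = ∑ j, C (g.1 i j) * X j := by
  simp [act]

theorem act_one (f : S m F) : act (1 : GL (Fin m ⊕ Fin m) F) f = f := by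
  have : act (1 : GL (Fin m ⊕ Fin m) F) = AlgHom.id F (S m F) := by
    apply MvPolynomial.algHom_ext
    intro i
    simp [act_X, Matrix.one_apply]
  rw [this]; rfl

theorem act_mul (g h : GL (Fin m ⊕ Fin m) F) (f : S m F) :
    act (g * h) f = act h (act g f) := by
  have : act (g * h) = (act h).comp (act g) := by
    apply MvPolynomial.algHom_ext
    intro i
    simp only [AlgHom.comp_apply, act_X, map_sum, map_mul, algHom_C, algebraMap_eq]
    simp only [Units.val_mul, Matrix.mul_apply, map_sum, map_mul, Finset.sum_mul, Finset.mul_sum,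
      mul_assoc]
    rw [Finset.sum_comm]
  rw [this]; rfl

variable (m F)

/-- `ξ_0 = ∑ y_k x_k`, and `ξ_i = ∑ (y_k^{q^i} x_k + y_k x_k^{q^i})` for `i > 0`, where `q = |F|`. -/
noncomputable def xi [Fintype F] (i : ℕ) : S m F :=
  if i = 0 then ∑ k, y m F k * x m F k
  else ∑ k, (y m F k ^ (Fintype.card F ^ i) * x m F k + y m F k * x m F k ^ (Fintype.card F ^ i))

/-- The orthogonal group of plus type: the matrices that fix the quadratic form `ξ_0`. -/
def orthPlus [Fintype F] : Subgroup (GL (Fin m ⊕ Fin m) F) where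
  carrier := {g | act g (xi m F 0) = xi m F 0}
  one_mem' := act_one _
  mul_mem' {g h} hg hh := by
    simp only [Set.mem_ofPred_eq] at hg hh ⊢
    rw [act_mul, hg, hh]
  inv_mem' {g} hg := by
    simp only [Set.mem_ofPred_eq] at hg ⊢
    conv_lhs => rw [← hg]
    rw [← act_mul, mul_inv_cancel, act_one]

/-- The subalgebra of invariants of a group of matrices. -/
noncomputable def invariants {m : ℕ} {F : Type*} [Field F]
    (G : Subgroup (GL (Fin m ⊕ Fin m) F)) : Subalgebra F (S m F) where
  carrier := {f | ∀ g ∈ G, act g f = f}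
  mul_mem' {a b} ha hb g hg := by rw [map_mul, ha g hg, hb g hg]
  add_mem' {a b} ha hb g hg := by rw [map_add, ha g hg, hb g hg]
  algebraMap_mem' r g _ := (act g).commutes r

/-- The position of a variable in the ordered list `y_1, …, y_m, x_m, …, x_1` (counted from `0`). -/
def pos {m : ℕ} : Fin m ⊕ Fin m → ℕ
  | Sum.inl i => i
  | Sum.inr i => 2 * m - 1 - i

theorem pos_injective {m : ℕ} : Function.Injective (pos (m := m)) := by
  rintro (i | i) (j | j) h <;> simp only [pos] at h
  · exact congrArg _ (Fin.ext h)
  · omega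
  · omega
  · exact congrArg _ (Fin.ext (by omega))

/-- The group of upper triangular unipotent matrices, with respect to the ordered basis
`y_1, …, y_m, x_m, …, x_1` of the space of linear forms. -/
def unitriangular : Subgroup (GL (Fin m ⊕ Fin m) F) where
  carrier := {g | (∀ i j, pos j < pos i → g.1 i j = 0) ∧ ∀ i, g.1 i i = 1}
  one_mem' := by
    refine ⟨fun i j h => ?_, fun i => by simp⟩
    have : i ≠ j := by rintro rfl; exact lt_irrefl _ h
    simp [this]
  mul_mem' {g h} hg hh := by
    refine ⟨Matrix.BlockTriangular.mul (b := pos) (fun i j => hg.1 i j) (fun i j => hh.1 i j),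
      fun i => ?_⟩
    rw [Units.val_mul, Matrix.mul_apply, Finset.sum_eq_single i, hg.2, hh.2, one_mul]
    · intro j _ hj
      rcases lt_or_gt_of_ne (pos_injective.ne hj) with hlt | hlt
      · rw [hg.1 _ _ hlt, zero_mul]
      · rw [hh.1 _ _ hlt, mul_zero]
    · simp
  inv_mem' {g} hg := by
    have htri : Matrix.BlockTriangular g.1 pos := fun i j => hg.1 i j
    have : Invertible g.1 := g.invertible
    have hinv : Matrix.BlockTriangular (g⁻¹).1 pos := by
      have := Matrix.blockTriangular_inv_of_blockTriangular htri
      rwa [← Matrix.coe_units_inv] at this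
    refine ⟨fun i j h => hinv h, fun i => ?_⟩
    have h1 : (g.1 * (g⁻¹).1) i i = 1 := by
      rw [← Units.val_mul, mul_inv_cancel]; simp
    rw [Matrix.mul_apply, Finset.sum_eq_single i, hg.2, one_mul] at h1
    · exact h1
    · intro j _ hj
      rcases lt_or_gt_of_ne (pos_injective.ne hj) with hlt | hlt
      · rw [hg.1 _ _ hlt, zero_mul]
      · rw [hinv hlt, mul_zero]
    · simp

variable [Fintype F]

/-- The Sylow subgroup `P_m`: the upper triangular unipotent matrices in the orthogonal group. -/
def sylowP : Subgroup (GL (Fin m ⊕ Fin m) F) := orthPlus m F ⊓ unitriangular m F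

variable {m F}

/-- The orbit of `f` under `P_m`. -/
def orbitP (f : S m F) : Set (S m F) := {w | ∃ g ∈ sylowP m F, act g f = w}

theorem orbitP_finite (f : S m F) : (orbitP f).Finite :=
  ((sylowP m F : Set (GL (Fin m ⊕ Fin m) F)).toFinite.image fun g => act g f)

/-- The orbit product `N(f)`: the product of the distinct elements of the `P_m`-orbit of `f`. -/
noncomputable def N (f : S m F) : S m F := ∏ w ∈ (orbitP_finite f).toFinset, w

variable (m F) in
/-- `u_m = ∏ N(y_i) N(x_i)`. -/
noncomputable def u : S m F := ∏ i, N (y m F i) * N (x m F i)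

/-- The complete Steenrod operator `𝒫(t) : S_m → S_m[t]`, the algebra homomorphism that sends each
variable `v` (and hence each linear form `v`) to `v + v^q t`. -/
noncomputable def steenrodTotal : S m F →ₐ[F] Polynomial (S m F) :=
  aeval fun i => Polynomial.C (X i) + Polynomial.C (X i ^ Fintype.card F) * Polynomial.X

/-- The Steenrod operation `𝒫^k`: the coefficient of `t^k` in `𝒫(t)`. -/
noncomputable def steenrod (k : ℕ) (f : S m F) : S m F := (steenrodTotal f).coeff k

theorem linear_pow_card (c : Fin m ⊕ Fin m → F) :
    (∑ j, C (c j) * X j : S m F) ^ Fintype.card F = ∑ j, C (c j) * X j ^ Fintype.card F := by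
  obtain ⟨p, hp⟩ := CharP.exists F
  obtain ⟨n, hprime, hn⟩ := FiniteField.card F p
  have : Fact p.Prime := ⟨hprime⟩
  have hc : ∀ a : F, a ^ (p ^ (n : ℕ)) = a := fun a => by rw [← hn]; exact FiniteField.pow_card a
  rw [hn, sum_pow_char_pow]
  refine Finset.sum_congr rfl fun j _ => ?_
  rw [mul_pow, ← C_pow, hc]

theorem steenrodTotal_linear (c : Fin m ⊕ Fin m → F) :
    steenrodTotal (∑ j, C (c j) * X j : S m F) =
      Polynomial.C (∑ j, C (c j) * X j) +
        Polynomial.C ((∑ j, C (c j) * X j) ^ Fintype.card F) * Polynomial.X := by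
  rw [linear_pow_card]
  have hC : ∀ a : F, steenrodTotal (C a : S m F) = Polynomial.C (C a) := fun a => by
    rw [← MvPolynomial.algebraMap_eq, AlgHom.commutes]; rfl
  have hX : ∀ j, steenrodTotal (X j : S m F) =
      Polynomial.C (X j) + Polynomial.C (X j ^ Fintype.card F) * Polynomial.X := fun j => by
    simp [steenrodTotal]
  simp only [map_sum, map_mul, hC, hX, mul_add, Finset.sum_add_distrib, Finset.sum_mul, mul_assoc]

theorem N_dvd_steenrodTotal (i : Fin m ⊕ Fin m) :
    Polynomial.C (N (X i : S m F)) ∣ steenrodTotal (N (X i : S m F)) := by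
  simp only [N, map_prod]
  refine Finset.prod_dvd_prod_of_dvd _ _ fun w hw => ?_
  obtain ⟨g, -, rfl⟩ := (orbitP_finite (X i : S m F)).mem_toFinset.1 hw
  rw [act_X, steenrodTotal_linear]
  refine dvd_add dvd_rfl (Dvd.dvd.mul_right ?_ _)
  rw [Polynomial.C_pow]
  exact dvd_pow_self _ Fintype.card_ne_zero

variable (m F) in
/-- `u_m` divides `𝒫^k(u_m)`. -/
theorem u_dvd_steenrod (k : ℕ) : u m F ∣ steenrod k (u m F) := by
  have h : Polynomial.C (u m F) ∣ steenrodTotal (u m F) := by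
    simp only [u, map_prod, map_mul]
    exact Finset.prod_dvd_prod_of_dvd _ _ fun i _ =>
      mul_dvd_mul (N_dvd_steenrodTotal _) (N_dvd_steenrodTotal _)
  exact (Polynomial.C_dvd_iff_dvd_coeff _ _).1 h k

variable (m F) in
/-- `u_m` is non-zero, so that the quotient of `𝒫^k(u_m)` by `u_m` is unique. -/
theorem u_ne_zero : u m F ≠ 0 := by
  have hN : ∀ i, N (X i : S m F) ≠ 0 := fun i => by
    refine Finset.prod_ne_zero_iff.2 fun w hw => ?_
    obtain ⟨g, -, rfl⟩ := (orbitP_finite (X i : S m F)).mem_toFinset.1 hw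
    intro h0
    have := act_mul g g⁻¹ (X i : S m F)
    rw [h0, map_zero, mul_inv_cancel, act_one] at this
    exact X_ne_zero i this
  exact Finset.prod_ne_zero_iff.2 fun i _ => mul_ne_zero (hN _) (hN _)

variable (F) in
/-- The exponent `e(i,m) = ∑_{j=1}^{i} q^{n-1-j}`, where `n = 2m` and `q = |F|`. -/
def e (i m : ℕ) : ℕ := ∑ j ∈ Finset.Icc 1 i, Fintype.card F ^ (2 * m - 1 - j)

variable (m F) in
/-- The invariant `d_{i,m}`, the unique polynomial with `u_m d_{i,m} = 𝒫^{e(i,m)}(u_m)`. -/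
noncomputable def d (i : ℕ) : S m F := (u_dvd_steenrod m F (e F i m)).choose

variable (m F) in
theorem u_mul_d (i : ℕ) : u m F * d m F i = steenrod (e F i m) (u m F) :=
  (u_dvd_steenrod m F (e F i m)).choose_spec.symm

variable (m F) in
/-- The family `ξ_0, …, ξ_{m-1}, d_{1,m}, …, d_{m,m}`. -/
noncomputable def H : Fin m ⊕ Fin m → S m F
  | Sum.inl i => xi m F i
  | Sum.inr i => d m F (i + 1)

end Defs

/-- A family `h` of polynomials is a homogeneous system of parameters for a graded subalgebra `A` of
a polynomial ring if its members are homogeneous elements of `A` of positive degree, are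
algebraically independent, and `A` is a finitely generated module over the subalgebra that they
generate. -/
structure IsHsop {F σ ι : Type*} [Field F] (A : Subalgebra F (MvPolynomial σ F))
    (h : ι → MvPolynomial σ F) : Prop where
  mem : ∀ i, h i ∈ A
  homogeneous : ∀ i, ∃ k : ℕ, 0 < k ∧ (h i).IsHomogeneous k
  algebraicIndependent : AlgebraicIndependent F h
  finite : Module.Finite (Algebra.adjoin F (Set.range fun i => (⟨h i, mem i⟩ : A))) A

end OrthInv

namespace OrthInv

open MvPolynomial Matrix

/-! ### Systems of parameters from the absence of common zeros -/

section Parameters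

variable {F σ ι : Type*} [Field F]

/-! By the Nullstellensatz and a graded Nakayama argument, homogeneous elements of positive degree
whose only common zero over an algebraically closed field is the origin make the polynomial ring a
finite module over the algebra they generate. If there are as many of them as variables,
transcendence degree gives independence, and finiteness passes to the invariants because the
generated algebra is Noetherian (`isHsop_of_forall_aeval_eq_zero`). So it remains to study common
zeros.

Let w be a zero of ξ_0, …, ξ_{m-1}, and r the dimension of the F-span of its entries. Up to a factor
2 when i = 0, ξ_i(w) is the polar form of w and its i-th Frobenius conjugate, so conjugates less
than m steps apart are orthogonal. The first r conjugates form a basis of a space defined over F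
(`span_frobVec_eq`). The heart is r ≤ m (`finrank_range_le`): for m < r < 2m the linear recurrence
satisfied by the conjugates contradicts the bound m on isotropic dimensions, and r = 2m is excluded
by comparing the Frobenius twist of the determinant of the conjugates with their Gram determinant,
where the plus type matters (`finrank_ne_two_mul`). Hence the space is totally isotropic.

On the other side, the P_m-orbits of the variables are the normalised singular vectors sorted by
leading position (`orbitP_X`). So u_m is a product of one linear form v per singular point, and
𝒫(t)(u_m) = u_m ∏ (1 + v^{q-1} t), where the second factor is invariant. Isotropy allows an exact
count of the singular points v with v(w) ≠ 0: there are e(r,m) of them (`card_reps_eq_e`). So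
d_{r,m}(w) is the top coefficient of the product evaluated at w, hence nonzero. For a common zero of
all the parameters only r = 0, that is w = 0, remains. -/

theorem exists_X_pow_mem_span_range [Finite σ] {K : Type*} [Field K] [IsAlgClosed K] [Algebra F K]
    {h : ι → MvPolynomial σ F} (hzero : ∀ w : σ → K, (∀ i, aeval w (h i) = 0) → w = 0) (i : σ) :
    ∃ k, (X i : MvPolynomial σ F) ^ k ∈ Ideal.span (Set.range h) := by
  have : (X i : MvPolynomial σ F) ∈ (Ideal.span (Set.range h)).radical := by
    rw [← vanishingIdeal_zeroLocus_eq_radical (K := K), zeroLocus_span]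
    intro w hw
    rw [hzero w fun i => hw _ ⟨i, rfl⟩]
    simp
  exact this

/-- If powers of all the variables lie in an ideal, so do all monomials of large degree. -/
theorem exists_forall_monomial_mem [Finite σ] {I : Ideal (MvPolynomial σ F)}
    (hI : ∀ i, ∃ k, (X i : MvPolynomial σ F) ^ k ∈ I) :
    ∃ N : ℕ, ∀ s : σ →₀ ℕ, N ≤ s.degree → ∀ c, monomial s c ∈ I := by
  cases nonempty_fintype σ
  choose k hk using hI
  refine ⟨∑ i, k i + 1, fun s hs c => ?_⟩
  obtain ⟨i, hi⟩ : ∃ i, k i ≤ s i := by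
    by_contra! hlt
    have : s.degree ≤ ∑ i, k i := by
      rw [Finsupp.degree_eq_sum]
      exact Finset.sum_le_sum fun i _ => (hlt i).le
    omega
  have : (monomial s c : MvPolynomial σ F) =
      monomial (s - Finsupp.single i (k i)) c * X i ^ k i := by
    rw [X_pow_eq_monomial, monomial_mul, mul_one, tsub_add_cancel_of_le]
    simpa using hi
  rw [this]
  exact I.mul_mem_left _ (hk i)

theorem homogeneousComponent_mul_of_isHomogeneous {f g : MvPolynomial σ F} {k : ℕ}
    (hg : g.IsHomogeneous k) (d : ℕ) :
    homogeneousComponent d (f * g) =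
      if k ≤ d then homogeneousComponent (d - k) f * g else 0 := by
  let _ := gradedAlgebra (σ := σ) (R := F)
  have hdec : ∀ (p : MvPolynomial σ F) (i : ℕ),
      (DirectSum.decompose (homogeneousSubmodule σ F) p i : MvPolynomial σ F) =
        homogeneousComponent i p := fun p i => decomposition.decompose'_apply p i
  have hg : g ∈ homogeneousSubmodule σ F k := hg
  rw [← hdec, ← hdec]
  split_ifs with h
  · exact DirectSum.coe_decompose_mul_of_right_mem_of_le _ hg h
  · exact DirectSum.coe_decompose_mul_of_right_mem_of_not_le _ hg h

/-- The graded Nakayama argument: a polynomial ring is spanned by finitely many monomials over a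
subalgebra containing homogeneous elements of positive degree without common zeros. -/
theorem span_monomials_eq_top [Finite ι] {h : ι → MvPolynomial σ F}
    (hhom : ∀ i, ∃ k : ℕ, 0 < k ∧ (h i).IsHomogeneous k)
    (B : Subalgebra F (MvPolynomial σ F)) (hB : ∀ i, h i ∈ B) {N : ℕ}
    (hN : ∀ s : σ →₀ ℕ, N ≤ s.degree → ∀ c, monomial s c ∈ Ideal.span (Set.range h)) :
    Submodule.span B ((fun s => monomial s (1 : F)) '' {s : σ →₀ ℕ | s.degree < N}) = ⊤ := by
  cases nonempty_fintype ι
  set M := Submodule.span B ((fun s => monomial s (1 : F)) '' {s : σ →₀ ℕ | s.degree < N})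
  have hF : ∀ (c : F) (f : MvPolynomial σ F), f ∈ M → C c * f ∈ M := fun c f hf => by
    have := M.smul_mem (algebraMap F B c) hf
    simpa [Algebra.smul_def] using this
  have hsum : ∀ f : MvPolynomial σ F, (∀ s ∈ f.support, monomial s (1 : F) ∈ M) → f ∈ M := by
    intro f hf
    rw [f.as_sum]
    refine M.sum_mem fun s hs => ?_
    rw [← mul_one (coeff s f), ← C_mul_monomial]
    exact hF _ _ (hf s hs)
  have key : ∀ d : ℕ, ∀ s : σ →₀ ℕ, s.degree = d → monomial s (1 : F) ∈ M := by
    intro d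
    induction d using Nat.strong_induction_on with
    | _ d ih =>
    intro s hs
    rcases lt_or_ge s.degree N with hlt | hge
    · exact Submodule.subset_span ⟨s, hlt, rfl⟩
    obtain ⟨g, hg⟩ := (Ideal.mem_span_range_iff_exists_fun).1 (hN s hge 1)
    -- In degree d only the components of degree d - k of the cofactors contribute, and k > 0 makes
    -- the induction hypothesis apply to their monomials.
    have hcomp := congrArg (homogeneousComponent d) hg
    rw [map_sum, homogeneousComponent_of_mem
      (show monomial s (1 : F) ∈ homogeneousSubmodule σ F d from
        isHomogeneous_monomial _ hs), if_pos rfl] at hcomp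
    rw [← hcomp]
    refine M.sum_mem fun i _ => ?_
    obtain ⟨k, hk, hhk⟩ := hhom i
    rw [homogeneousComponent_mul_of_isHomogeneous hhk]
    split_ifs with hkd
    · rw [mul_comm]
      refine M.smul_mem (⟨h i, hB i⟩ : B) (hsum _ fun t ht => ?_)
      exact ih (d - k) (by omega) t
        ((homogeneousComponent_isHomogeneous (d - k) (g i)).degree_eq_sum_deg_support ht).symm
    · exact M.zero_mem
  exact eq_top_iff.2 fun f _ => hsum f fun s _ => key _ s rfl

theorem finite_of_forall_aeval_eq_zero [Finite σ] [Finite ι]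
    {K : Type*} [Field K] [IsAlgClosed K] [Algebra F K]
    {h : ι → MvPolynomial σ F} (hhom : ∀ i, ∃ k : ℕ, 0 < k ∧ (h i).IsHomogeneous k)
    (hzero : ∀ w : σ → K, (∀ i, aeval w (h i) = 0) → w = 0)
    (B : Subalgebra F (MvPolynomial σ F)) (hB : ∀ i, h i ∈ B) :
    Module.Finite B (MvPolynomial σ F) := by
  obtain ⟨N, hN⟩ := exists_forall_monomial_mem (exists_X_pow_mem_span_range hzero)
  refine ⟨Submodule.fg_def.2 ⟨_, ?_, span_monomials_eq_top hhom B hB hN⟩⟩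
  exact ((Finsupp.finite_of_degree_le N).subset fun s (hs : s.degree < N) => hs.le).image _

/-- Criterion for a system of parameters: as many homogeneous invariants of positive degree as
there are variables, without a common zero over an algebraically closed field. -/
theorem isHsop_of_forall_aeval_eq_zero [Finite σ]
    {K : Type*} [Field K] [IsAlgClosed K] [Algebra F K]
    {A : Subalgebra F (MvPolynomial σ F)} {h : σ → MvPolynomial σ F} (hmem : ∀ i, h i ∈ A)
    (hhom : ∀ i, ∃ k : ℕ, 0 < k ∧ (h i).IsHomogeneous k)
    (hzero : ∀ w : σ → K, (∀ i, aeval w (h i) = 0) → w = 0) : IsHsop A h where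
  mem := hmem
  homogeneous := hhom
  algebraicIndependent := by
    have := finite_of_forall_aeval_eq_zero hhom hzero (Algebra.adjoin F (Set.range h))
      fun i => Algebra.subset_adjoin ⟨i, rfl⟩
    -- The ring is algebraic over the generated algebra, and a generating family no larger than the
    -- transcendence degree must be independent.
    refine (Algebra.IsAlgebraic.isTranscendenceBasis_of_lift_le_trdeg_of_finite F h ?_).1
    rw [MvPolynomial.trdeg_of_isDomain]
    simp
  finite := by
    set B := Algebra.adjoin F (Set.range fun i => (⟨h i, hmem i⟩ : A))
    have hfin : Module.Finite (B.map A.val) (MvPolynomial σ F) :=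
      finite_of_forall_aeval_eq_zero hhom hzero _
        fun i => ⟨⟨h i, hmem i⟩, Algebra.subset_adjoin ⟨i, rfl⟩, rfl⟩
    have hB : IsNoetherianRing B := by
      have : Algebra.FiniteType F B :=
        (Subalgebra.fg_iff_finiteType _).1 (Subalgebra.fg_def.2 ⟨_, Set.finite_range _, rfl⟩)
      exact Algebra.FiniteType.isNoetherianRing F B
    -- `B` lives inside `A`, so finiteness over its image in the polynomial ring is carried back
    -- along the inclusion.
    have hfin' : Module.Finite B (MvPolynomial σ F) := by
      obtain ⟨s, hs⟩ := hfin
      refine ⟨s, eq_top_iff.2 fun f _ => ?_⟩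
      have hf : f ∈ Submodule.span (B.map A.val) (s : Set (MvPolynomial σ F)) := hs ▸ trivial
      induction hf using Submodule.span_induction with
      | mem x hx => exact Submodule.subset_span hx
      | zero => exact Submodule.zero_mem _
      | add x y _ _ hx hy => exact Submodule.add_mem _ (hx trivial) (hy trivial)
      | smul a x _ hx =>
        obtain ⟨_, b, hb, rfl⟩ := a
        exact Submodule.smul_mem _ (⟨b, hb⟩ : B) (hx trivial)
    have : IsNoetherian B (MvPolynomial σ F) := 
      isNoetherian_of_isNoetherianRing_of_finite B (MvPolynomial σ F)
    exact Module.Finite.of_injective (M := A) (N := MvPolynomial σ F)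
      ({ toFun := Subtype.val, map_add' := fun _ _ => rfl, map_smul' := fun _ _ => rfl } :
        A →ₗ[B] MvPolynomial σ F) Subtype.val_injective

end Parameters

/-! ### The hyperbolic form and its Gram matrix -/

section Form

variable {m : ℕ} {R : Type*} [CommRing R]

/-- The hyperbolic quadratic form `∑ a_{y_k} a_{x_k}`. -/
def hyp (a : Fin m ⊕ Fin m → R) : R := ∑ k, a (Sum.inl k) * a (Sum.inr k)

variable (m R) in
/-- The Gram matrix of the polar form of `hyp`. -/
def gram : Matrix (Fin m ⊕ Fin m) (Fin m ⊕ Fin m) R := fromBlocks 0 1 1 0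

/-- The polar form of `hyp`. -/
def polar : LinearMap.BilinForm R (Fin m ⊕ Fin m → R) :=
  LinearMap.mk₂ R (fun a b => ∑ k, a k * b k.swap)
    (fun a b c => by simp [add_mul, Finset.sum_add_distrib])
    (fun r a b => by simp only [Pi.smul_apply, smul_eq_mul, Finset.mul_sum, mul_assoc])
    (fun a b c => by simp [mul_add, Finset.sum_add_distrib])
    (fun r a b => by simp only [Pi.smul_apply, smul_eq_mul, Finset.mul_sum, mul_left_comm])

theorem polar_apply (a b : Fin m ⊕ Fin m → R) : polar a b = ∑ k, a k * b k.swap := rfl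

theorem polar_comm (a b : Fin m ⊕ Fin m → R) : polar a b = polar b a := by
  simp only [polar_apply, Fintype.sum_sum_type, Sum.swap_inl, Sum.swap_inr]
  rw [add_comm]
  simp only [mul_comm]

theorem polar_self (a : Fin m ⊕ Fin m → R) : polar a a = 2 * hyp a := by
  simp only [polar_apply, hyp, Fintype.sum_sum_type, Sum.swap_inl, Sum.swap_inr, two_mul]
  simp only [mul_comm]

theorem hyp_smul (c : R) (a : Fin m ⊕ Fin m → R) : hyp (c • a) = c ^ 2 * hyp a := by
  simp only [hyp, Pi.smul_apply, smul_eq_mul, Finset.mul_sum]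
  exact Finset.sum_congr rfl fun k _ => by ring

theorem hyp_add (a b : Fin m ⊕ Fin m → R) : hyp (a + b) = hyp a + hyp b + polar a b := by
  simp only [hyp, polar_apply, Fintype.sum_sum_type, Sum.swap_inl, Sum.swap_inr, Pi.add_apply,
    ← Finset.sum_add_distrib]
  exact Finset.sum_congr rfl fun k _ => by ring

theorem polar_map {R' : Type*} [CommRing R'] (f : R →+* R') (a b : Fin m ⊕ Fin m → R) :
    polar (fun k => f (a k)) (fun k => f (b k)) = f (polar a b) := by
  simp [polar_apply]

theorem polar_single_left (i : Fin m ⊕ Fin m) (b : Fin m ⊕ Fin m → R) :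
    polar (Pi.single i 1) b = b i.swap := by
  simp [polar_apply, Pi.single_apply]

theorem polar_single_right (i : Fin m ⊕ Fin m) (b : Fin m ⊕ Fin m → R) :
    polar b (Pi.single i 1) = b i.swap := by
  rw [polar_comm, polar_single_left]

theorem gram_apply (i j : Fin m ⊕ Fin m) : gram m R i j = if j = i.swap then 1 else 0 := by
  rcases i with i | i <;> rcases j with j | j <;> simp [gram, one_apply, eq_comm]

theorem gram_mul_gram : gram m R * gram m R = 1 := by
  simp [gram, fromBlocks_multiply]

theorem gram_mulVec (b : Fin m ⊕ Fin m → R) : gram m R *ᵥ b = fun k => b k.swap := by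
  ext k
  simp [mulVec, dotProduct, gram_apply]

theorem polar_eq_dotProduct (a b : Fin m ⊕ Fin m → R) : polar a b = a ⬝ᵥ gram m R *ᵥ b := by
  rw [gram_mulVec]; rfl

theorem gram_map {R' : Type*} [CommRing R'] (f : R →+* R') :
    (gram m R).map f = gram m R' := by
  ext i j
  simp [gram_apply, apply_ite f]

theorem mul_gram_mul_transpose_apply (A : Matrix (Fin m ⊕ Fin m) (Fin m ⊕ Fin m) R)
    (i j : Fin m ⊕ Fin m) : (A * gram m R * Aᵀ) i j = polar (A i) (A j) := by
  rw [polar_eq_dotProduct, Matrix.mul_assoc, mul_apply]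
  rfl

/-- As the Gram matrix is an involution, either identity says that `A` has a certain one-sided
inverse, and such inverses are two-sided. This passes between conditions on rows and on columns. -/
theorem mul_gram_mul_transpose_iff {A : Matrix (Fin m ⊕ Fin m) (Fin m ⊕ Fin m) R} :
    A * gram m R * Aᵀ = gram m R ↔ Aᵀ * gram m R * A = gram m R := by
  have key : ∀ A B : Matrix (Fin m ⊕ Fin m) (Fin m ⊕ Fin m) R,
      A * gram m R * B = gram m R → B * gram m R * A = gram m R := by
    intro A B h
    have h1 : A * (gram m R * B * gram m R) = 1 := by
      rw [← gram_mul_gram (m := m) (R := R), ← Matrix.mul_assoc, ← Matrix.mul_assoc, h]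
    have h2 := congrArg (gram m R * ·) (mul_eq_one_comm.1 h1)
    simpa only [← Matrix.mul_assoc, gram_mul_gram, Matrix.one_mul, Matrix.mul_one] using h2
  exact ⟨key _ _, key _ _⟩

theorem polar_mulVec {A : Matrix (Fin m ⊕ Fin m) (Fin m ⊕ Fin m) R}
    (hA : Aᵀ * gram m R * A = gram m R) (a b : Fin m ⊕ Fin m → R) :
    polar (A *ᵥ a) (A *ᵥ b) = polar a b := by
  rw [polar_eq_dotProduct, polar_eq_dotProduct, ← vecMul_transpose, ← dotProduct_mulVec,
    mulVec_mulVec, mulVec_mulVec, hA]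

theorem polar_vecMul {A : Matrix (Fin m ⊕ Fin m) (Fin m ⊕ Fin m) R}
    (hA : A * gram m R * Aᵀ = gram m R) (a b : Fin m ⊕ Fin m → R) :
    polar (a ᵥ* A) (b ᵥ* A) = polar a b := by
  rw [← mulVec_transpose, ← mulVec_transpose]
  exact polar_mulVec (by simpa using hA) a b

end Form

/-! ### Invariance and degree of the ξ_i -/

section Invariance

variable {m : ℕ} {F : Type*} [Field F]

theorem xi_zero [Fintype F] : xi m F 0 = hyp (X : Fin m ⊕ Fin m → S m F) := by
  simp [xi, hyp, x, y]

theorem xi_of_ne_zero [Fintype F] {i : ℕ} (hi : i ≠ 0) :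
    xi m F i = polar (fun k => (X k : S m F) ^ Fintype.card F ^ i) X := by
  simp [xi, hi, polar_apply, x, y, Finset.sum_add_distrib, mul_comm]

theorem hyp_map {R R' : Type*} [CommRing R] [CommRing R'] (f : R →+* R') (a : Fin m ⊕ Fin m → R) :
    hyp (fun k => f (a k)) = f (hyp a) := by
  simp [hyp]

theorem act_X_eq_mulVec (g : GL (Fin m ⊕ Fin m) F) (i : Fin m ⊕ Fin m) :
    act g (X i : S m F) = (g.1.map (C : F →+* S m F) *ᵥ X) i := by
  rw [act_X]; rfl

theorem linear_pow_card_pow [Fintype F] (c : Fin m ⊕ Fin m → F) (i : ℕ) :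
    (∑ j, C (c j) * X j : S m F) ^ Fintype.card F ^ i =
      ∑ j, C (c j) * X j ^ Fintype.card F ^ i := by
  obtain ⟨p, hp⟩ := CharP.exists F
  obtain ⟨n, hprime, hn⟩ := FiniteField.card F p
  have : Fact p.Prime := ⟨hprime⟩
  have hq : Fintype.card F ^ i = p ^ (n * i : ℕ) := by rw [hn, pow_mul]
  rw [hq, sum_pow_char_pow]
  refine Finset.sum_congr rfl fun j _ => ?_
  rw [mul_pow, ← C_pow, ← hq, FiniteField.pow_card_pow]

/-- Frobenius fixes the entries of `g`, so the q^i-th powers of the variables transform by the same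
matrix as the variables. This is why the ξ_i are invariant. -/
theorem act_X_pow_eq_mulVec [Fintype F] (g : GL (Fin m ⊕ Fin m) F) (i : ℕ) (k : Fin m ⊕ Fin m) :
    act g (X k ^ Fintype.card F ^ i : S m F) =
      (g.1.map (C : F →+* S m F) *ᵥ fun k => X k ^ Fintype.card F ^ i) k := by
  rw [map_pow, act_X, linear_pow_card_pow]; rfl

theorem map_gram_identity {g : Matrix (Fin m ⊕ Fin m) (Fin m ⊕ Fin m) F}
    {R : Type*} [CommRing R] (f : F →+* R) (hg : gᵀ * gram m F * g = gram m F) :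
    (g.map f)ᵀ * gram m R * g.map f = gram m R := by
  have := congrArg (fun M => M.map f) hg
  simpa only [Matrix.map_mul, gram_map, transpose_map] using this

theorem act_polar [Fintype F] {g : GL (Fin m ⊕ Fin m) F} (hg : g.1ᵀ * gram m F * g.1 = gram m F) (i : ℕ) :
    act g (polar (fun k => (X k : S m F) ^ Fintype.card F ^ i) X) =
      polar (fun k => (X k : S m F) ^ Fintype.card F ^ i) X := by
  have h := polar_map (act g : S m F →+* S m F) (fun k => X k ^ Fintype.card F ^ i) X
  simp only [RingHom.coe_coe, act_X_eq_mulVec, act_X_pow_eq_mulVec] at h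
  rw [← h]
  exact polar_mulVec (map_gram_identity _ hg) _ _

/-- Polarisation of the values on F-points gives the matrix identity; conversely that identity fixes
`polar X X`, which is 2ξ_0, and 2 can be cancelled. -/
theorem mem_orthPlus_iff [Fintype F] (hF : ringChar F ≠ 2) {g : GL (Fin m ⊕ Fin m) F} :
    g ∈ orthPlus m F ↔ g.1ᵀ * gram m F * g.1 = gram m F := by
  constructor
  · intro hg
    have hg : act g (xi m F 0) = xi m F 0 := hg
    have hh : ∀ a : Fin m ⊕ Fin m → F, hyp (g.1 *ᵥ a) = hyp a := by
      intro a
      have h1 := congrArg (aeval (R := F) a) hg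
      rw [xi_zero, ← AlgHom.comp_apply] at h1
      have h2 := hyp_map (((aeval a).comp (act g) : S m F →ₐ[F] F) : S m F →+* F)
        (X : Fin m ⊕ Fin m → S m F)
      have h3 := hyp_map ((aeval a : S m F →ₐ[F] F) : S m F →+* F) (X : Fin m ⊕ Fin m → S m F)
      simp only [RingHom.coe_coe] at h2 h3
      rw [← h2, ← h3] at h1
      convert h1 using 2
      · ext k
        simp [act_X, mulVec, dotProduct]
      · ext k
        simp
    have hp : ∀ a b : Fin m ⊕ Fin m → F, polar (g.1 *ᵥ a) (g.1 *ᵥ b) = polar a b := by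
      intro a b
      have := hh (a + b)
      rw [mulVec_add, hyp_add, hyp_add, hh, hh] at this
      exact add_left_cancel this
    ext i j
    have := hp (Pi.single i 1) (Pi.single j 1)
    rw [mulVec_single_one, mulVec_single_one, polar_single_left] at this
    have h4 := mul_gram_mul_transpose_apply (g.1ᵀ) i j
    rw [transpose_transpose] at h4
    rw [h4, gram_apply, ← Pi.single_apply]
    rw [Pi.single_comm]
    exact this
  · intro hg
    change act g (xi m F 0) = xi m F 0
    have h := act_polar hg 0
    simp only [pow_zero, pow_one] at h
    have h2 : (2 : S m F) ≠ 0 := fun h0 =>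
      Ring.two_ne_zero hF (C_injective (Fin m ⊕ Fin m) F (by rw [map_ofNat, h0, map_zero]))
    change act g (polar X X) = polar X X at h
    rw [polar_self, map_mul, map_ofNat] at h
    rw [xi_zero]
    exact mul_left_cancel₀ h2 h

theorem xi_mem_invariants [Fintype F] (hF : ringChar F ≠ 2) (i : ℕ) :
    xi m F i ∈ invariants (orthPlus m F) := by
  intro g hg
  rcases eq_or_ne i 0 with rfl | hi
  · exact hg
  · rw [xi_of_ne_zero hi]
    exact act_polar ((mem_orthPlus_iff hF).1 hg) i

theorem xi_isHomogeneous [Fintype F] (i : ℕ) : (xi m F i).IsHomogeneous (Fintype.card F ^ i + 1) := by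
  have hX : ∀ k, (X k : S m F).IsHomogeneous 1 := isHomogeneous_X F
  rcases eq_or_ne i 0 with rfl | hi
  · rw [xi_zero]
    exact IsHomogeneous.sum _ _ _ fun k _ => by simpa using (hX _).mul (hX _)
  · rw [xi_of_ne_zero hi, polar_apply]
    exact IsHomogeneous.sum _ _ _ fun k _ => by
      simpa using ((hX k).pow (Fintype.card F ^ i)).mul (hX k.swap)

end Invariance

/-! ### Linear forms -/

section LinearForms

variable {m : ℕ} {F : Type*} [Field F]

/-- The linear form with the given row vector of coefficients. -/
noncomputable def linForm (v : Fin m ⊕ Fin m → F) : S m F := ∑ j, C (v j) * X j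

theorem linForm_smul (c : F) (v : Fin m ⊕ Fin m → F) : linForm (c • v) = C c * linForm v := by
  simp only [linForm, Pi.smul_apply, smul_eq_mul, C_mul, Finset.mul_sum, mul_assoc]

theorem linForm_injective : Function.Injective (linForm : (Fin m ⊕ Fin m → F) → S m F) := by
  intro v w h
  ext i
  have := congrArg (coeff (Finsupp.single i 1)) h
  simpa only [linForm, coeff_sum, coeff_C_mul, coeff_X, Finsupp.single_left_inj one_ne_zero,
    mul_ite, mul_one, mul_zero, Finset.sum_ite_eq', Finset.sum_ite_eq, Finset.mem_univ, if_true]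
    using this

theorem linForm_isHomogeneous (v : Fin m ⊕ Fin m → F) : (linForm v).IsHomogeneous 1 :=
  IsHomogeneous.sum _ _ _ fun _ _ => isHomogeneous_C_mul_X _ _

theorem act_linForm (g : GL (Fin m ⊕ Fin m) F) (v : Fin m ⊕ Fin m → F) :
    act g (linForm v) = linForm (v ᵥ* g.1) := by
  simp only [linForm, map_sum, map_mul, algHom_C, algebraMap_eq, act_X, vecMul, dotProduct,
    Finset.mul_sum, Finset.sum_mul]
  rw [Finset.sum_comm]
  simp only [mul_assoc]

theorem act_X_eq_linForm (g : GL (Fin m ⊕ Fin m) F) (i : Fin m ⊕ Fin m) :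
    act g (X i) = linForm (g.1 i) := act_X g i

end LinearForms

/-! ### Singular points, orbit products and the invariants d_{i,m} -/

section Singular

variable {m : ℕ} {F : Type*} [Field F]

theorem pos_swap (i : Fin m ⊕ Fin m) : pos i.swap + pos i = 2 * m - 1 := by
  rcases i with i | i <;> simp only [pos, Sum.swap_inl, Sum.swap_inr] <;> omega

/-- A singular vector whose leading coefficient is `1`, at the position `i`. -/
def IsLeadSingular (i : Fin m ⊕ Fin m) (v : Fin m ⊕ Fin m → F) : Prop :=
  hyp v = 0 ∧ v i = 1 ∧ ∀ j, pos j < pos i → v j = 0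

theorem IsLeadSingular.polar_self {i : Fin m ⊕ Fin m} {v : Fin m ⊕ Fin m → F}
    (hv : IsLeadSingular i v) : polar v v = 0 := by
  rw [OrthInv.polar_self, hv.1, mul_zero]

theorem swap_ne (i : Fin m ⊕ Fin m) : i.swap ≠ i := by
  rcases i with i | i <;> simp

/-- The rows of the Siegel transformation that sends the basis vector `i` to `v`. -/
def siegel (i : Fin m ⊕ Fin m) (v : Fin m ⊕ Fin m → F) :
    Matrix (Fin m ⊕ Fin m) (Fin m ⊕ Fin m) F := fun j =>
  if j = i then v
  else if j = i.swap then Pi.single i.swap 1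
  else Pi.single j 1 - v j.swap • Pi.single i.swap 1

theorem siegel_self (i : Fin m ⊕ Fin m) (v : Fin m ⊕ Fin m → F) : siegel i v i = v := by
  simp [siegel]

theorem siegel_swap (i : Fin m ⊕ Fin m) (v : Fin m ⊕ Fin m → F) :
    siegel i v i.swap = Pi.single i.swap 1 := by
  simp [siegel, swap_ne]

theorem siegel_of_ne {i j : Fin m ⊕ Fin m} (h : j ≠ i) (h' : j ≠ i.swap)
    (v : Fin m ⊕ Fin m → F) :
    siegel i v j = Pi.single j 1 - v j.swap • Pi.single i.swap 1 := by
  simp [siegel, h, h']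

theorem polar_siegel {i : Fin m ⊕ Fin m} {v : Fin m ⊕ Fin m → F} (hv : IsLeadSingular i v)
    (j k : Fin m ⊕ Fin m) :
    polar (siegel i v j) (siegel i v k) = gram m F j k := by
  have hi := swap_ne i
  have hv1 := hv.2.1
  have hsw : ∀ {a b : Fin m ⊕ Fin m}, a = b.swap → b = a.swap := fun h => by
    rw [h, Sum.swap_swap]
  rw [gram_apply]
  rcases eq_or_ne j i with rfl | hji
  · rw [siegel_self]
    rcases eq_or_ne k j with rfl | hkj
    · rw [siegel_self, hv.polar_self, if_neg hi.symm]
    rcases eq_or_ne k j.swap with rfl | hkj'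
    · rw [siegel_swap, polar_single_right, Sum.swap_swap, hv1, if_pos rfl]
    · rw [siegel_of_ne hkj hkj', map_sub, map_smul, polar_single_right, polar_single_right,
        Sum.swap_swap, hv1, if_neg hkj', smul_eq_mul, mul_one, sub_self]
  rcases eq_or_ne j i.swap with rfl | hji'
  · rw [siegel_swap, polar_single_left, Sum.swap_swap]
    rcases eq_or_ne k i with rfl | hki
    · rw [siegel_self, hv1, if_pos rfl]
    rcases eq_or_ne k i.swap with rfl | hki'
    · rw [siegel_swap, Pi.single_eq_of_ne hi.symm, if_neg hi]
    · rw [siegel_of_ne hki hki', Pi.sub_apply, Pi.smul_apply, Pi.single_eq_of_ne hki.symm,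
        Pi.single_eq_of_ne hi.symm, if_neg hki, smul_zero, sub_zero]
  · rw [siegel_of_ne hji hji', map_sub, map_smul, LinearMap.sub_apply, LinearMap.smul_apply,
      polar_single_left, polar_single_left, Sum.swap_swap]
    rcases eq_or_ne k i with rfl | hki
    · rw [siegel_self, hv1, if_neg fun h => hji' (hsw h), smul_eq_mul, mul_one, sub_self]
    rcases eq_or_ne k i.swap with rfl | hki'
    · rw [siegel_swap, Pi.single_eq_of_ne hi.symm, Pi.single_eq_of_ne fun h => hji (by
        rw [← Sum.swap_swap j, h, Sum.swap_swap]), if_neg fun h => hji (by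
        rw [← Sum.swap_swap j, ← h, Sum.swap_swap]), smul_zero, sub_zero]
    · have hne : j.swap ≠ i.swap := fun h => hji (by rw [← Sum.swap_swap j, h, Sum.swap_swap])
      have h1 : (Pi.single i.swap 1 : Fin m ⊕ Fin m → F) j.swap = 0 := Pi.single_eq_of_ne hne 1
      have h2 : (Pi.single i.swap 1 : Fin m ⊕ Fin m → F) i = 0 := Pi.single_eq_of_ne hi.symm 1
      have h3 : (Pi.single k 1 : Fin m ⊕ Fin m → F) i = 0 := Pi.single_eq_of_ne hki.symm 1
      rw [siegel_of_ne hki hki', Pi.sub_apply, Pi.sub_apply, Pi.smul_apply, Pi.smul_apply, h1, h2,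
        h3, Pi.single_apply]
      simp [eq_comm]

theorem siegel_triangular {i : Fin m ⊕ Fin m} {v : Fin m ⊕ Fin m → F} (hv : IsLeadSingular i v) :
    (∀ j k, pos k < pos j → siegel i v j k = 0) ∧ ∀ j, siegel i v j j = 1 := by
  constructor
  · intro j k hjk
    unfold siegel
    split_ifs with h1 h2
    · subst h1; exact hv.2.2 k hjk
    · subst h2
      rw [Pi.single_apply, if_neg]
      rintro rfl; exact lt_irrefl _ hjk
    · have hkj : k ≠ j := by rintro rfl; exact lt_irrefl _ hjk
      rw [Pi.sub_apply, Pi.single_apply, if_neg hkj, Pi.smul_apply, Pi.single_apply]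
      split_ifs with h3
      · subst h3
        -- `Sum.swap` reverses positions, so an entry in column `i.swap` below the diagonal is a
        -- coefficient of `v` before its leading position.
        have h4 := pos_swap i
        have h5 := pos_swap j
        rw [hv.2.2 j.swap (by omega)]
        simp
      · simp
  · intro j
    unfold siegel
    split_ifs with h1 h2
    · subst h1; exact hv.2.1
    · subst h2; simp
    · simp [h2]

theorem exists_mem_sylowP_row_eq [Fintype F] (hF : ringChar F ≠ 2) {i : Fin m ⊕ Fin m}
    {v : Fin m ⊕ Fin m → F} (hv : IsLeadSingular i v) : ∃ g ∈ sylowP m F, g.1 i = v := by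
  have h : siegel i v * gram m F * (siegel i v)ᵀ = gram m F := by
    ext j k
    rw [mul_gram_mul_transpose_apply, polar_siegel hv]
  have h1 : siegel i v * (gram m F * (siegel i v)ᵀ * gram m F) = 1 := by
    rw [← gram_mul_gram, ← Matrix.mul_assoc, ← Matrix.mul_assoc, h]
  refine ⟨⟨siegel i v, _, h1, mul_eq_one_comm.1 h1⟩, ⟨?_, siegel_triangular hv⟩, siegel_self i v⟩
  exact (mem_orthPlus_iff hF).2 (mul_gram_mul_transpose_iff.1 h)

theorem hyp_vecMul [Fintype F] (hF : ringChar F ≠ 2) {g : GL (Fin m ⊕ Fin m) F}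
    (hg : g ∈ orthPlus m F) (v : Fin m ⊕ Fin m → F) : hyp (v ᵥ* g.1) = hyp v := by
  have := polar_vecMul (mul_gram_mul_transpose_iff.2 ((mem_orthPlus_iff hF).1 hg)) v v
  rw [polar_self, polar_self] at this
  exact mul_left_cancel₀ (Ring.two_ne_zero hF) this

theorem hyp_single (i : Fin m ⊕ Fin m) : hyp (Pi.single i (1 : F)) = 0 := by
  rcases i with i | i <;> simp [hyp]

/-- Unitriangular isometries preserve singularity and the leading coefficient 1; conversely, the
Siegel transformation reaches every such vector. -/
theorem orbitP_X [Fintype F] (hF : ringChar F ≠ 2) (i : Fin m ⊕ Fin m) :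
    orbitP (X i : S m F) = linForm '' {v | IsLeadSingular i v} := by
  ext f
  constructor
  · rintro ⟨g, hg, rfl⟩
    refine ⟨g.1 i, ⟨?_, hg.2.2 i, hg.2.1 i⟩, (act_X_eq_linForm g i).symm⟩
    have h := hyp_vecMul hF hg.1 (Pi.single i 1)
    rwa [single_one_vecMul, hyp_single] at h
  · rintro ⟨v, hv, rfl⟩
    obtain ⟨g, hg, rfl⟩ := exists_mem_sylowP_row_eq hF hv
    exact ⟨g, hg, act_X_eq_linForm g i⟩

open Classical in
/-- The normalised representatives of the singular points. -/
noncomputable def singularReps (m : ℕ) (F : Type*) [Field F] [Fintype F] :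
    Finset (Fin m ⊕ Fin m → F) := {v | ∃ i, IsLeadSingular i v}

theorem mem_singularReps [Fintype F] {v : Fin m ⊕ Fin m → F} :
    v ∈ singularReps m F ↔ ∃ i, IsLeadSingular i v := by
  simp [singularReps]

/-- Scaling keeps the leading position, and the leading coefficient determines the scalar: a
singular point has a single normalised representative. -/
theorem IsLeadSingular.index_eq {i j : Fin m ⊕ Fin m} {v : Fin m ⊕ Fin m → F} {c : F}
    (hi : IsLeadSingular i v) (hj : IsLeadSingular j (c • v)) : i = j ∧ c = 1 := by
  have hc : c ≠ 0 := by
    rintro rfl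
    have := hj.2.1
    simp at this
  have hij : i = j := by
    apply pos_injective
    rcases lt_trichotomy (pos i) (pos j) with h | h | h
    · have := hj.2.2 i h
      simp [hi.2.1, hc] at this
    · exact h
    · have h1 := hj.2.1
      simp [hi.2.2 j h] at h1
  subst hij
  have := hj.2.1
  rw [Pi.smul_apply, hi.2.1] at this
  exact ⟨rfl, by simpa using this⟩

theorem exists_smul_mem_singularReps [Fintype F] {v : Fin m ⊕ Fin m → F} (hv : hyp v = 0)
    (h0 : v ≠ 0) : ∃ c : F, c ≠ 0 ∧ c • v ∈ singularReps m F := by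
  classical
  obtain ⟨j, hj⟩ := Function.ne_iff.1 h0
  obtain ⟨i, hi, hmin⟩ := Finset.exists_min_image (Finset.univ.filter fun j => v j ≠ 0) pos
    ⟨j, by simpa using hj⟩
  rw [Finset.mem_filter] at hi
  refine ⟨(v i)⁻¹, inv_ne_zero hi.2, mem_singularReps.2 ⟨i, ?_, ?_, fun k hk => ?_⟩⟩
  · rw [hyp_smul, hv, mul_zero]
  · simp [hi.2]
  · by_contra hne
    have := hmin k (by simpa [hi.2] using hne)
    omega

theorem ne_zero_of_mem_singularReps [Fintype F] {v : Fin m ⊕ Fin m → F}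
    (hv : v ∈ singularReps m F) : v ≠ 0 := by
  rintro rfl
  obtain ⟨i, hi⟩ := mem_singularReps.1 hv
  simpa using hi.2.1

theorem eq_one_of_smul_mem_singularReps [Fintype F] {v : Fin m ⊕ Fin m → F} {c : F}
    (hv : v ∈ singularReps m F) (hc : c • v ∈ singularReps m F) : c = 1 := by
  obtain ⟨i, hi⟩ := mem_singularReps.1 hv
  obtain ⟨j, hj⟩ := mem_singularReps.1 hc
  exact (hi.index_eq hj).2

theorem hyp_of_mem_singularReps [Fintype F] {v : Fin m ⊕ Fin m → F}
    (hv : v ∈ singularReps m F) : hyp v = 0 := by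
  obtain ⟨i, hi⟩ := mem_singularReps.1 hv
  exact hi.1

theorem u_eq_prod [Fintype F] (hF : ringChar F ≠ 2) :
    u m F = ∏ v ∈ singularReps m F, linForm v := by
  classical
  have hN : ∀ i, N (X i : S m F) =
      ∏ v ∈ (Finset.univ.filter fun v => IsLeadSingular i v), linForm v := by
    intro i
    rw [N]
    refine Eq.trans ?_ (Finset.prod_image (g := linForm) (f := id)
      fun a _ b _ h => linForm_injective h)
    refine Finset.prod_congr ?_ fun _ _ => rfl
    ext f
    simp [orbitP_X hF]
  have hu : u m F = ∏ i, N (X i : S m F) := by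
    rw [u, Fintype.prod_sum_type, Finset.prod_mul_distrib]; rfl
  rw [hu, Finset.prod_congr rfl fun i _ => hN i, ← Finset.prod_biUnion]
  · refine Finset.prod_congr ?_ fun _ _ => rfl
    ext v
    simp [mem_singularReps]
  · intro i _ j _ hij
    rw [Function.onFun, Finset.disjoint_left]
    intro v hi hj
    rw [Finset.mem_filter] at hi hj
    exact hij (hi.2.index_eq (c := 1) (by simpa using hj.2)).1

/-- The total Chern class `∏ (1 + v^{q-1} t)` of the singular points `v`. -/
noncomputable def chern (m : ℕ) (F : Type*) [Field F] [Fintype F] : Polynomial (S m F) :=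
  ∏ v ∈ singularReps m F,
    (1 + Polynomial.C (linForm v ^ (Fintype.card F - 1)) * Polynomial.X)

/-- Each factor splits as v + v^q t = v (1 + v^{q-1} t). -/
theorem steenrodTotal_u [Fintype F] (hF : ringChar F ≠ 2) :
    steenrodTotal (u m F) = Polynomial.C (u m F) * chern m F := by
  rw [u_eq_prod hF, map_prod, map_prod, chern, ← Finset.prod_mul_distrib]
  refine Finset.prod_congr rfl fun v _ => ?_
  rw [linForm, steenrodTotal_linear, mul_add, mul_one, ← mul_assoc, ← Polynomial.C_mul,
    mul_pow_sub_one Fintype.card_ne_zero]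

theorem d_eq_coeff_chern [Fintype F] (hF : ringChar F ≠ 2) (i : ℕ) :
    d m F i = (chern m F).coeff (e F i m) := by
  apply mul_left_cancel₀ (u_ne_zero m F)
  rw [u_mul_d, steenrod, steenrodTotal_u hF, Polynomial.coeff_C_mul]

theorem linForm_pow_smul [Fintype F] {c : F} (hc : c ≠ 0) (v : Fin m ⊕ Fin m → F) :
    linForm (c • v) ^ (Fintype.card F - 1) = linForm v ^ (Fintype.card F - 1) := by
  rw [linForm_smul, mul_pow, ← C_pow, FiniteField.pow_card_sub_one_eq_one c hc, C_1, one_mul]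

/-- An isometry permutes the singular points, and rescaling an image to its representative does not
change its (q-1)-th power. -/
theorem map_act_chern [Fintype F] (hF : ringChar F ≠ 2) {g : GL (Fin m ⊕ Fin m) F}
    (hg : g ∈ orthPlus m F) : (chern m F).map (act g : S m F →+* S m F) = chern m F := by
  have hinj : ∀ v w : Fin m ⊕ Fin m → F, v ᵥ* g.1 = w ᵥ* g.1 → v = w := fun v w h => by
    have := congrArg (· ᵥ* (g⁻¹).1) h
    simpa [vecMul_vecMul, ← Units.val_mul] using this
  have hex : ∀ v, ∃ c : F, v ∈ singularReps m F → c ≠ 0 ∧ c • (v ᵥ* g.1) ∈ singularReps m F := by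
    intro v
    by_cases hv : v ∈ singularReps m F
    · obtain ⟨c, hc⟩ := exists_smul_mem_singularReps (v := v ᵥ* g.1)
        (by rw [hyp_vecMul hF hg, hyp_of_mem_singularReps hv])
        (fun h => ne_zero_of_mem_singularReps hv (hinj _ _ (by rw [h, zero_vecMul])))
      exact ⟨c, fun _ => hc⟩
    · exact ⟨0, fun h => absurd h hv⟩
  choose c hc using hex
  have hinjOn : Set.InjOn (fun v => c v • (v ᵥ* g.1)) (singularReps m F) := by
    intro v hv w hw h
    dsimp only at h
    have hvw : w = ((c w)⁻¹ * c v) • v := by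
      apply hinj
      rw [smul_vecMul, mul_smul, h, smul_smul, inv_mul_cancel₀ (hc w hw).1, one_smul]
    rw [hvw] at hw
    rw [hvw, eq_one_of_smul_mem_singularReps hv hw, one_smul]
  rw [chern, Polynomial.map_prod]
  refine Finset.prod_nbij _ (fun v hv => (hc v hv).2) hinjOn
    (Finset.surjOn_of_injOn_of_card_le _ (fun v hv => (hc v hv).2) hinjOn le_rfl) ?_
  · intro v hv
    rw [linForm_pow_smul (hc v hv).1, ← act_linForm]
    simp

theorem coeff_prod_one_add_isHomogeneous {σ κ R : Type*} [CommRing R] (s : Finset κ)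
    (a : κ → MvPolynomial σ R) {r : ℕ} (ha : ∀ i ∈ s, (a i).IsHomogeneous r) (k : ℕ) :
    ((∏ i ∈ s, (1 + Polynomial.C (a i) * Polynomial.X)).coeff k).IsHomogeneous (k * r) := by
  classical
  induction s using Finset.induction_on generalizing k with
  | empty =>
    rw [Finset.prod_empty, Polynomial.coeff_one]
    split_ifs with h
    · subst h; simpa using isHomogeneous_one σ R
    · exact isHomogeneous_zero _ _ _
  | insert i s hi ih =>
    have ih := ih fun j hj => ha j (Finset.mem_insert_of_mem hj)
    rw [Finset.prod_insert hi, add_mul, one_mul, Polynomial.coeff_add]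
    refine (ih k).add ?_
    rw [mul_assoc, Polynomial.coeff_C_mul]
    cases k with
    | zero => simpa using isHomogeneous_zero _ _ _
    | succ k =>
      rw [Polynomial.coeff_X_mul, add_mul, add_comm, one_mul]
      exact (ha i (Finset.mem_insert_self _ _)).mul (ih k)

theorem d_mem_invariants [Fintype F] (hF : ringChar F ≠ 2) (i : ℕ) :
    d m F i ∈ invariants (orthPlus m F) := by
  intro g hg
  rw [d_eq_coeff_chern hF]
  conv_rhs => rw [← map_act_chern hF hg]
  rw [Polynomial.coeff_map]; rfl

theorem d_isHomogeneous [Fintype F] (hF : ringChar F ≠ 2) (i : ℕ) :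
    (d m F i).IsHomogeneous (e F i m * (Fintype.card F - 1)) := by
  rw [d_eq_coeff_chern hF]
  exact coeff_prod_one_add_isHomogeneous _ _
    (fun v _ => by simpa using (linForm_isHomogeneous v).pow _) _

end Singular

/-! ### Frobenius conjugates and rational subspaces -/

section Frobenius

variable {κ F K : Type*} [Field F] [Fintype F] [Field K] [Algebra F K]

/-- The vector of `q^i`-th powers. -/
def frobVec (F : Type*) [Fintype F] {κ K : Type*} [Field K] (w : κ → K) (i : ℕ) : κ → K :=
  fun k => w k ^ Fintype.card F ^ i

theorem sum_smul_pow_card_pow [Fintype κ] (c : κ → F) (w : κ → K) (i : ℕ) :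
    (∑ k, c k • w k) ^ Fintype.card F ^ i = ∑ k, c k • w k ^ Fintype.card F ^ i := by
  have h : ∀ z : K, (FiniteField.frobeniusAlgHom F K ^ i) z = z ^ Fintype.card F ^ i := by
    intro z
    induction i with
    | zero => simp
    | succ i ih => rw [pow_succ', AlgHom.mul_apply, ih, FiniteField.frobeniusAlgHom_apply,
        ← pow_mul, pow_succ]
  rw [← h, map_sum]
  exact Finset.sum_congr rfl fun k _ => by rw [map_smul, h]

/-- The Moore criterion: over `K`, the first `r` Frobenius conjugates of a vector are independent,
where `r` is the dimension of the `F`-span of its entries. -/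
theorem linearIndependent_frobVec [Fintype κ] (w : κ → K) :
    LinearIndependent K fun i : Fin (Module.finrank F (Fintype.linearCombination F w).range) =>
      frobVec F w i := by
  classical
  set φ := Fintype.linearCombination F w
  rw [Fintype.linearIndependent_iff]
  intro p hp
  have hq : 1 < Fintype.card F := Fintype.one_lt_card
  -- A linear relation among the conjugates gives a q-polynomial that vanishes on the F-span of the
  -- entries. This span has q^r elements, while the degree is at most q^{r-1}.
  set P : Polynomial K := ∑ i, Polynomial.C (p i) * Polynomial.X ^ Fintype.card F ^ (i : ℕ) with hP
  have heval : ∀ z ∈ φ.range, P.eval z = 0 := by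
    rintro _ ⟨v, rfl⟩
    rw [hP, Polynomial.eval_finsetSum]
    simp only [Polynomial.eval_mul, Polynomial.eval_C, Polynomial.eval_pow, Polynomial.eval_X, φ,
      Fintype.linearCombination_apply, sum_smul_pow_card_pow, Finset.mul_sum]
    rw [Finset.sum_comm]
    refine Finset.sum_eq_zero fun k _ => ?_
    have := congrFun hp k
    simp only [Finset.sum_apply, Pi.smul_apply, smul_eq_mul, frobVec, Pi.zero_apply] at this
    simp only [mul_smul_comm]
    rw [← Finset.smul_sum, this, smul_zero]
  have : Finite φ.range := Module.finite_of_finite F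
  have := Fintype.ofFinite φ.range
  have hP0 : P = 0 := by
    by_cases hr : Module.finrank F φ.range = 0
    · have : IsEmpty (Fin (Module.finrank F φ.range)) := by rw [hr]; infer_instance
      simp [hP]
    refine Polynomial.eq_zero_of_natDegree_lt_card_of_eval_eq_zero' P
      (φ.range : Set K).toFinset (fun z hz => heval z (by simpa using hz)) ?_
    have hcard : (φ.range : Set K).toFinset.card =
        Fintype.card F ^ Module.finrank F φ.range := by
      rw [Set.toFinset_card, ← Module.card_eq_pow_finrank]
      exact Fintype.card_congr (Equiv.refl _)
    rw [hcard]
    refine lt_of_le_of_lt (Polynomial.natDegree_sum_le_of_forall_le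
      (n := Fintype.card F ^ (Module.finrank F φ.range - 1)) _ _ fun i _ => ?_)
      (Nat.pow_lt_pow_right hq (by omega))
    refine (Polynomial.natDegree_C_mul_X_pow_le _ _).trans (Nat.pow_le_pow_right hq.le ?_)
    have := i.2
    omega
  intro i
  have := congrArg (Polynomial.coeff · (Fintype.card F ^ (i : ℕ))) hP0
  simpa [hP, Polynomial.finsetSum_coeff, Polynomial.coeff_C_mul, Polynomial.coeff_X_pow,
    (Nat.pow_right_injective hq).eq_iff, Fin.val_inj] using this

/-- Coordinates of the entries of a vector with respect to a basis of their `F`-span. -/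
theorem exists_rational_decomposition {κ F K : Type*} [Field F] [Field K] [Algebra F K]
    [Fintype κ] (w : κ → K) :
    ∃ (z : Fin (Module.finrank F (Fintype.linearCombination F w).range) → K)
      (l : Fin (Module.finrank F (Fintype.linearCombination F w).range) → κ → F),
      LinearIndependent F z ∧ ∀ k, w k = ∑ a, l a k • z a := by
  classical
  set φ := Fintype.linearCombination F w
  have hw : ∀ k, w k ∈ φ.range := fun k => ⟨Pi.single k 1, by simp [φ]⟩
  let b := Module.finBasis F φ.range
  refine ⟨fun a => b a, fun a k => b.repr ⟨w k, hw k⟩ a,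
    b.linearIndependent.map' φ.range.subtype (Submodule.ker_subtype _), fun k => ?_⟩
  have := congrArg φ.range.subtype (b.sum_repr ⟨w k, hw k⟩)
  rw [map_sum] at this
  exact this.symm

theorem frobVec_eq_sum {ι : Type*} [Fintype ι] {w : κ → K} {z : ι → K} {l : ι → κ → F}
    (h : ∀ k, w k = ∑ a, l a k • z a) (i : ℕ) :
    frobVec F w i = ∑ a, z a ^ Fintype.card F ^ i • fun k => algebraMap F K (l a k) := by
  ext k
  rw [frobVec, h, sum_smul_pow_card_pow, Finset.sum_apply]
  exact Finset.sum_congr rfl fun a _ => by rw [Algebra.smul_def, mul_comm]; rfl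

/-- All conjugates are combinations of the same r rational vectors, and r of them are independent,
so the spans agree. In particular the span of the conjugates is defined over F. -/
theorem span_frobVec_eq [Fintype κ] {w : κ → K}
    {z : Fin (Module.finrank F (Fintype.linearCombination F w).range) → K}
    {l : Fin (Module.finrank F (Fintype.linearCombination F w).range) → κ → F}
    (h : ∀ k, w k = ∑ a, l a k • z a) :
    Submodule.span K (Set.range fun i : Fin (Module.finrank F
      (Fintype.linearCombination F w).range) => frobVec F w i) =
    Submodule.span K (Set.range fun a k => algebraMap F K (l a k)) := by
  refine Submodule.eq_of_le_of_finrank_le ?_ ?_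
  · rw [Submodule.span_le]
    rintro _ ⟨i, rfl⟩
    rw [SetLike.mem_coe, Submodule.mem_span_range_iff_exists_fun]
    exact ⟨_, (frobVec_eq_sum h i).symm⟩
  · rw [finrank_span_eq_card (linearIndependent_frobVec w)]
    exact finrank_range_le_card _

theorem frobVec_mem_span [Fintype κ] (w : κ → K) (i : ℕ) :
    frobVec F w i ∈ Submodule.span K (Set.range fun i : Fin (Module.finrank F
      (Fintype.linearCombination F w).range) => frobVec F w i) := by
  obtain ⟨z, l, -, h⟩ := exists_rational_decomposition (F := F) w
  rw [span_frobVec_eq h, Submodule.mem_span_range_iff_exists_fun]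
  exact ⟨_, (frobVec_eq_sum h i).symm⟩

end Frobenius

/-! ### Isotropic subspaces -/

section Isotropic

variable {m : ℕ} {K : Type*} [Field K]

theorem polar_nondegenerate :
    (polar : LinearMap.BilinForm K (Fin m ⊕ Fin m → K)).Nondegenerate := by
  have h : ∀ a : Fin m ⊕ Fin m → K, (∀ b, polar b a = 0) → a = 0 := fun a ha => by
    ext k
    have := ha (Pi.single k.swap 1)
    rwa [polar_single_left, Sum.swap_swap] at this
  exact ⟨fun a ha => h a fun b => by rw [polar_comm]; exact ha b, fun a ha => h a ha⟩

/-- A totally isotropic subspace has dimension at most `m`. -/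
theorem card_le_of_isotropic {ι : Type*} [Fintype ι] {f : ι → Fin m ⊕ Fin m → K}
    (hf : LinearIndependent K f) (h : ∀ i j, polar (f i) (f j) = 0) : Fintype.card ι ≤ m := by
  set U := Submodule.span K (Set.range f)
  have hle : U ≤ (polar : LinearMap.BilinForm K _).orthogonal U := by
    rw [Submodule.span_le]
    rintro _ ⟨j, rfl⟩
    rw [SetLike.mem_coe, LinearMap.BilinForm.mem_orthogonal_iff]
    intro u hu
    change polar u (f j) = 0
    induction hu using Submodule.span_induction with
    | mem _ hx => obtain ⟨i, rfl⟩ := hx; exact h i j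
    | zero => rw [map_zero, LinearMap.zero_apply]
    | add a b _ _ ha hb => rw [map_add, LinearMap.add_apply, ha, hb, add_zero]
    | smul c a _ ha => rw [map_smul, LinearMap.smul_apply, ha, smul_zero]
  have h1 := Submodule.finrank_mono hle
  have h2 := LinearMap.BilinForm.finrank_orthogonal polar_nondegenerate U
  have h3 : Module.finrank K U = Fintype.card ι := finrank_span_eq_card hf
  rw [h2, h3] at h1
  simp only [Module.finrank_fintype_fun_eq_card, Fintype.card_sum, Fintype.card_fin] at h1
  omega

end Isotropic

/-! ### Conjugates of a common zero of the ξ_i -/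

section Conjugates

variable {m : ℕ} {F K : Type*} [Field F] [Fintype F] [Field K] [Algebra F K]

theorem frobVec_succ (w : Fin m ⊕ Fin m → K) (i : ℕ) :
    frobVec F w (i + 1) = fun k => FiniteField.frobeniusAlgHom F K (frobVec F w i k) := by
  ext k
  rw [FiniteField.frobeniusAlgHom_apply, frobVec, frobVec, ← pow_mul, pow_succ]

theorem polar_frobVec_succ (w : Fin m ⊕ Fin m → K) (i j : ℕ) :
    polar (frobVec F w (i + 1)) (frobVec F w (j + 1)) =
      polar (frobVec F w i) (frobVec F w j) ^ Fintype.card F := by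
  rw [frobVec_succ, frobVec_succ]
  exact polar_map ((FiniteField.frobeniusAlgHom F K : K →ₐ[F] K) : K →+* K) _ _

theorem polar_frobVec_add (w : Fin m ⊕ Fin m → K) (i j : ℕ) :
    polar (frobVec F w i) (frobVec F w (i + j)) =
      polar (frobVec F w 0) (frobVec F w j) ^ Fintype.card F ^ i := by
  induction i with
  | zero => simp
  | succ i ih => rw [Nat.add_right_comm, polar_frobVec_succ, ih, ← pow_mul, pow_succ]

/-- Up to Frobenius, the pairing of two conjugates depends only on the distance of their indices. -/
theorem polar_frobVec_eq_zero {w : Fin m ⊕ Fin m → K} {n : ℕ}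
    (h : ∀ i < n, polar (frobVec F w 0) (frobVec F w i) = 0) {i j : ℕ} (hij : i < j + n)
    (hji : j < i + n) : polar (frobVec F w i) (frobVec F w j) = 0 := by
  have key : ∀ i j : ℕ, i ≤ j → j < i + n → polar (frobVec F w i) (frobVec F w j) = 0 := by
    intro i j hle hlt
    obtain ⟨k, rfl⟩ := Nat.exists_eq_add_of_le hle
    rw [polar_frobVec_add, h k (by omega), zero_pow (pow_ne_zero _ Fintype.card_ne_zero)]
  rcases le_total i j with hle | hle
  · exact key i j hle hji
  · rw [polar_comm]; exact key j i hle hij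

theorem val_finRotate {n : ℕ} (i : Fin n) :
    (finRotate n i : ℕ) = if (i : ℕ) + 1 = n then 0 else (i : ℕ) + 1 := by
  cases n with
  | zero => exact i.elim0
  | succ n => rw [coe_finRotate]; simp only [Fin.ext_iff, Fin.val_last, add_left_inj]

/-- The plus type of the form enters here: a vector whose conjugates span the whole space cannot
be orthogonal to its first `m - 1` conjugates. -/
theorem finrank_ne_two_mul (hF : ringChar F ≠ 2) (hm : 1 ≤ m) {w : Fin m ⊕ Fin m → K}
    (h : ∀ i < m, polar (frobVec F w 0) (frobVec F w i) = 0) :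
    Module.finrank F (Fintype.linearCombination F w).range ≠ m + m := by
  intro hr
  set q := Fintype.card F with hq
  set c := polar (frobVec F w 0) (frobVec F w m) with hc
  let ε : Fin m ⊕ Fin m ≃ Fin (m + m) := finSumFinEquiv
  let M : Matrix (Fin m ⊕ Fin m) (Fin m ⊕ Fin m) K := fun i => frobVec F w (ε i)
  have hli : LinearIndependent K fun i : Fin (m + m) => frobVec F w i := by
    have := linearIndependent_frobVec (F := F) w
    rwa [hr] at this
  have hdet : M.det ≠ 0 := by
    have h1 : LinearIndependent K M.row := hli.comp ε ε.injective
    exact ((Matrix.isUnit_iff_isUnit_det _).1 (linearIndependent_rows_iff_isUnit.1 h1)).ne_zero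
  obtain ⟨a, ha⟩ : ∃ a : Fin m ⊕ Fin m → K, ∑ i, a i • M i = frobVec F w (m + m) := by
    have h1 := frobVec_mem_span (F := F) w (m + m)
    rw [hr, Submodule.mem_span_range_iff_exists_fun] at h1
    obtain ⟨a, ha⟩ := h1
    refine ⟨fun i => a (ε i), ?_⟩
    rw [← ha, ← Equiv.sum_comp ε]
  let i₀ : Fin m ⊕ Fin m := Sum.inl ⟨0, hm⟩
  have hε₀ : (ε i₀ : ℕ) = 0 := rfl
  -- the coefficient of the first conjugate
  have ha₀ : a i₀ * c = c ^ q ^ m := by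
    have h1 := polar_frobVec_add (F := F) w m m
    rw [polar_comm, ← ha, map_sum, LinearMap.sum_apply] at h1
    -- The conjugates 1, …, 2m - 1 are less than m steps from conjugate m, hence orthogonal to it;
    -- only conjugate 0 survives.
    rw [← h1, Finset.sum_eq_single i₀]
    · simp [M, hε₀, hc]
    · intro j _ hj
      have h2 : (ε j : ℕ) ≠ 0 := fun h0 => hj (ε.injective (Fin.ext (h0.trans hε₀.symm)))
      have h3 := (ε j).2
      rw [map_smul, LinearMap.smul_apply, polar_frobVec_eq_zero h (by omega) (by omega), smul_zero]
    · simp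
  -- the Frobenius twist of the determinant
  have hfrob : M.det ^ q = -(a i₀ * M.det) := by
    -- Frobenius shifts the rows cyclically, except that conjugate 2m replaces conjugate 0. The
    -- shift is a cycle of even length 2m, hence odd, and only the `a i₀` part of the new row
    -- contributes to the determinant.
    let σ : Equiv.Perm (Fin m ⊕ Fin m) := (ε.trans (finRotate (m + m))).trans ε.symm
    have hσ : Equiv.Perm.sign σ = -1 := by
      have : σ = ((ε.symm.symm.trans (finRotate (m + m))).trans ε.symm) := rfl
      rw [this, Equiv.Perm.sign_symm_trans_trans, sign_finRotate]
      exact Odd.neg_one_pow ⟨m - 1, by omega⟩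
    have h1 : M.map (FiniteField.frobeniusAlgHom F K) =
        (M.updateRow i₀ (∑ i, a i • M i)).submatrix σ id := by
      ext i k
      have h2 : M.map (FiniteField.frobeniusAlgHom F K) i k = frobVec F w (ε i + 1) k := by
        rw [frobVec_succ]; rfl
      rw [h2, submatrix_apply, id, ha]
      have hσi : ε (σ i) = finRotate (m + m) (ε i) := by simp [σ]
      have h3 : ((finRotate (m + m) (ε i) : Fin (m + m)) : ℕ) =
          if (ε i : ℕ) + 1 = m + m then 0 else (ε i : ℕ) + 1 := by
        rw [val_finRotate]
      split_ifs at h3 with h4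
      · have : σ i = i₀ := ε.injective (Fin.ext (by rw [hσi, h3, hε₀]))
        rw [this, updateRow_self, h4]
      · have : σ i ≠ i₀ := fun h0 => by
          rw [← hσi, h0, hε₀] at h3
          omega
        rw [updateRow_ne this]
        change _ = frobVec F w (ε (σ i)) k
        rw [hσi, h3]
    have h2 := (FiniteField.frobeniusAlgHom F K).map_det M
    rw [FiniteField.frobeniusAlgHom_apply] at h2
    rw [hq, h2, AlgHom.mapMatrix_apply, h1, det_permute, hσ, det_updateRow_sum]
    simp
  -- the Gram determinant
  obtain ⟨t, ht, ht2, ht0⟩ : ∃ t : K, M.det ^ 2 = t ^ 2 ∧ t ^ (q - 1) * c = c ^ q ^ m ∧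
      (c = 0 → t = 0) := by
    -- The first m conjugates are mutually orthogonal, so the Gram matrix of the conjugates is
    -- determined up to sign by its off-diagonal block `C`, which is triangular with diagonal
    -- c^{q^i}; `t` is `C.det`.
    let C : Matrix (Fin m) (Fin m) K := fun i j => polar (frobVec F w i) (frobVec F w (m + j))
    let D : Matrix (Fin m) (Fin m) K := fun i j => polar (frobVec F w (m + i)) (frobVec F w (m + j))
    have hC : C.det = ∏ i : Fin m, c ^ q ^ (i : ℕ) := by
      rw [det_of_isUpperTriangular]
      · refine Finset.prod_congr rfl fun i _ => ?_
        change polar (frobVec F w i) (frobVec F w (m + i)) = _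
        rw [add_comm, polar_frobVec_add]
      · intro i j hij
        have : (j : ℕ) < i := hij
        exact polar_frobVec_eq_zero h (by omega) (by omega)
    refine ⟨C.det, ?_, ?_, fun hc0 => ?_⟩
    · have h1 : M * gram m K * Mᵀ = fromBlocks 0 C Cᵀ D := by
        ext i j
        rw [mul_gram_mul_transpose_apply]
        rcases i with i | i <;> rcases j with j | j
        · exact polar_frobVec_eq_zero h (by simp [ε]; omega) (by simp [ε]; omega)
        · rfl
        · exact polar_comm _ _
        · rfl
      -- Multiplication by `gram` exchanges the block columns, which leaves a block triangular
      -- matrix with diagonal blocks `C` and `Cᵀ` and avoids computing the sign of `(gram m K).det`.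
      have h2 := congrArg (fun A => (A * gram m K).det) h1
      have h3 : (gram m K).det * (gram m K).det = 1 := by
        rw [← det_mul, gram_mul_gram, det_one]
      simp only [gram, fromBlocks_multiply, Matrix.mul_zero, Matrix.mul_one, zero_add, add_zero,
        det_fromBlocks_zero₁₂, det_transpose] at h2
      rw [← gram, det_mul, det_mul, det_mul, det_transpose] at h2
      linear_combination h2 - M.det ^ 2 * h3
    · rw [hC, Finset.prod_pow_eq_pow_sum, ← pow_mul, ← pow_succ, Fin.sum_univ_eq_sum_range (q ^ ·)]
      congr 1
      have h2 : 1 ≤ q := Fintype.card_pos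
      have h3 := Nat.geomSum_eq (Fintype.one_lt_card : 1 < q) m
      have h4 : q - 1 ∣ q ^ m - 1 := by simpa using Nat.sub_dvd_pow_sub_pow q 1 m
      rw [h3, Nat.div_mul_cancel h4, Nat.sub_add_cancel (Nat.one_le_pow _ _ h2)]
    · rw [hC, hc0]
      exact Finset.prod_eq_zero (Finset.mem_univ ⟨0, hm⟩) (by simp)
  have hodd := FiniteField.odd_card_of_char_ne_two hF
  -- As q - 1 is even, the sign ambiguity between the determinant and `t` disappears.
  have hpow : M.det ^ (q - 1) = t ^ (q - 1) := by
    have : q - 1 = 2 * (q / 2) := by omega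
    rw [this, pow_mul, pow_mul, ht]
  have h1 : M.det ^ (q - 1) = -a i₀ := by
    apply mul_right_cancel₀ hdet
    rw [← pow_succ, Nat.sub_add_cancel Fintype.card_pos, hfrob, neg_mul]
  have h2 : (2 : K) ≠ 0 := by
    have := (algebraMap F K).injective.ne (Ring.two_ne_zero hF)
    rwa [map_ofNat, map_zero] at this
  -- Now -a₀ = t^{q-1}, so c^{q^m} equals both a₀c and -a₀c.
  have hc0 : c = 0 := by
    have h3 : (2 : K) * c ^ q ^ m = 0 := by
      rw [← hpow, h1] at ht2
      linear_combination -ht2 - ha₀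
    rcases mul_eq_zero.1 h3 with h4 | h4
    · exact absurd h4 h2
    · exact pow_eq_zero_iff (pow_ne_zero _ Fintype.card_ne_zero) |>.1 h4
  rw [ht0 hc0] at ht
  exact hdet (pow_eq_zero_iff two_ne_zero |>.1 (by rw [ht]; simp))

/-- If r > m, the pairing of conjugates 0 and m is nonzero, since otherwise m + 1 independent
conjugates would be mutually orthogonal. For r < 2m, pairing conjugate r with conjugate r - m, which
is orthogonal to all of conjugates 0, …, r - 1, contradicts the recurrence. -/
theorem finrank_range_le (hF : ringChar F ≠ 2) (hm : 1 ≤ m) {w : Fin m ⊕ Fin m → K}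
    (h : ∀ i < m, polar (frobVec F w 0) (frobVec F w i) = 0) :
    Module.finrank F (Fintype.linearCombination F w).range ≤ m := by
  by_contra! hlt
  set r := Module.finrank F (Fintype.linearCombination F w).range with hr
  have hli : LinearIndependent K fun i : Fin r => frobVec F w i := linearIndependent_frobVec w
  have hr2 : r ≤ m + m := by
    simpa using hli.fintype_card_le_finrank
  have hc : polar (frobVec F w 0) (frobVec F w m) ≠ 0 := by
    intro hc
    have h' : ∀ i < m + 1, polar (frobVec F w 0) (frobVec F w i) = 0 := fun i hi => by
      rcases Nat.lt_succ_iff_lt_or_eq.1 hi with hi | rfl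
      · exact h i hi
      · exact hc
    have := card_le_of_isotropic (hli.comp (Fin.castLE hlt) (Fin.castLE_injective _))
      fun i j => polar_frobVec_eq_zero h' (by simp; omega) (by simp; omega)
    simp at this
  have hr3 : r ≠ m + m := finrank_ne_two_mul hF hm h
  obtain ⟨a, ha⟩ := (Submodule.mem_span_range_iff_exists_fun K).1 (frobVec_mem_span (F := F) w r)
  have h1 := polar_frobVec_add (F := F) w (r - m) m
  rw [Nat.sub_add_cancel hlt.le, ← ha, map_sum, Finset.sum_eq_zero] at h1
  · exact pow_ne_zero _ hc h1.symm
  · intro i _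
    have hi : (i : ℕ) < r := i.2
    rw [map_smul, polar_frobVec_eq_zero h (by omega) (by omega), smul_zero]

/-- The rational vectors spanning the space of conjugates of a common zero of the `ξ_i` span a
totally isotropic subspace. -/
theorem polar_rational_eq_zero (hF : ringChar F ≠ 2) (hm : 1 ≤ m) {w : Fin m ⊕ Fin m → K}
    (h : ∀ i < m, polar (frobVec F w 0) (frobVec F w i) = 0)
    {z : Fin (Module.finrank F (Fintype.linearCombination F w).range) → K}
    {l : Fin (Module.finrank F (Fintype.linearCombination F w).range) → Fin m ⊕ Fin m → F}
    (hl : ∀ k, w k = ∑ a, l a k • z a)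
    (a b : Fin (Module.finrank F (Fintype.linearCombination F w).range)) :
    polar (l a) (l b) = 0 := by
  have hr := finrank_range_le hF hm h
  -- The rational vectors are combinations of conjugates with indices below r ≤ m, any two of which
  -- are orthogonal.
  have hmem : ∀ a, ∃ p : Fin (Module.finrank F (Fintype.linearCombination F w).range) → K,
      ∑ i, p i • frobVec F w i = fun k => algebraMap F K (l a k) := fun a => by
    rw [← Submodule.mem_span_range_iff_exists_fun, span_frobVec_eq hl]
    exact Submodule.subset_span ⟨a, rfl⟩
  obtain ⟨p, hp⟩ := hmem a
  obtain ⟨p', hp'⟩ := hmem b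
  apply (algebraMap F K).injective
  rw [← polar_map, ← hp, ← hp', map_zero, map_sum]
  refine Finset.sum_eq_zero fun j _ => ?_
  rw [map_sum, LinearMap.sum_apply]
  refine Finset.sum_eq_zero fun i _ => ?_
  have hi := i.2
  have hj := j.2
  rw [map_smul, map_smul, LinearMap.smul_apply, polar_frobVec_eq_zero h (by omega) (by omega),
    smul_zero, smul_zero]

end Conjugates

/-! ### Counting singular points outside a kernel -/

section Counting

variable {m : ℕ} {F K : Type*} [Field F] [Fintype F] [Field K] [Algebra F K]

/-- If each nonzero value of a linear map admits a singular vector in the kernel that is not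
orthogonal to the fibre, then exactly one `q`-th of the vectors outside the kernel are singular. -/
theorem card_ne_zero_eq_card_mul (φ : (Fin m ⊕ Fin m → F) →ₗ[F] K)
    (h : ∀ z : K, z ≠ 0 → ∃ t, φ t = 0 ∧ hyp t = 0 ∧ ∀ v, φ v = z → polar v t ≠ 0) :
    Nat.card {v // φ v ≠ 0} = Nat.card {v // φ v ≠ 0 ∧ hyp v = 0} * Fintype.card F := by
  have h' : ∀ z : K, ∃ t, φ t = 0 ∧ hyp t = 0 ∧ (z ≠ 0 → ∀ v, φ v = z → polar v t ≠ 0) := by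
    intro z
    by_cases hz : z = 0
    · exact ⟨0, map_zero _, by simp [hyp], fun h => absurd hz h⟩
    · obtain ⟨t, h1, h2, h3⟩ := h z hz
      exact ⟨t, h1, h2, fun _ => h3⟩
  choose t ht0 hts htp using h'
  have hφ : ∀ (v : Fin m ⊕ Fin m → F) (z : K) (c : F), φ (v + c • t z) = φ v := fun v z c => by
    rw [map_add, map_smul, ht0, smul_zero, add_zero]
  have hhyp : ∀ (v : Fin m ⊕ Fin m → F) (z : K) (c : F),
      hyp (v + c • t z) = hyp v + c * polar v (t z) := fun v z c => by
    rw [hyp_add, hyp_smul, hts, mul_zero, add_zero, map_smul, smul_eq_mul]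
  have hpol : ∀ (v : Fin m ⊕ Fin m → F) (z : K) (c : F),
      polar (v + c • t z) (t z) = polar v (t z) := fun v z c => by
    rw [map_add, map_smul, LinearMap.add_apply, LinearMap.smul_apply, polar_self, hts, mul_zero,
      smul_zero, add_zero]
  rw [← Nat.card_eq_fintype_card (α := F), ← Nat.card_prod]
  -- On the line v + c t, with t chosen for the value φ(v), both φ and the pairing with t are
  -- constant, so `hyp` is affine in c with nonzero slope. Thus v corresponds to the unique singular
  -- vector on its line, together with `hyp v`.
  refine Nat.card_congr
    { toFun := fun v => (⟨v.1 + (-hyp v.1 / polar v.1 (t (φ v.1))) • t (φ v.1), ?_, ?_⟩, hyp v.1)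
      invFun := fun p => ⟨p.1.1 + (p.2 / polar p.1.1 (t (φ p.1.1))) • t (φ p.1.1), ?_⟩
      left_inv := ?_
      right_inv := ?_ }
  · rw [hφ]; exact v.2
  · rw [hhyp, div_mul_cancel₀ _ (htp _ v.2 _ rfl), add_neg_cancel]
  · rw [hφ]; exact p.1.2.1
  · rintro ⟨v, hv⟩
    apply Subtype.ext
    simp only [hφ, hpol]
    rw [add_assoc, ← add_smul, ← add_div, neg_add_cancel, zero_div, zero_smul, add_zero]
  · rintro ⟨⟨v, hv, hs⟩, c⟩
    have h1 : hyp (v + (c / polar v (t (φ v))) • t (φ v)) = c := by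
      rw [hhyp, hs, zero_add, div_mul_cancel₀ _ (htp _ hv _ rfl)]
    refine Prod.ext (Subtype.ext ?_) h1
    simp only [hφ, hpol, h1]
    rw [add_assoc, ← add_smul, ← add_div, add_neg_cancel, zero_div, zero_smul, add_zero]

theorem card_singular_eq_card_reps_mul (φ : (Fin m ⊕ Fin m → F) →ₗ[F] K) :
    Nat.card {v // φ v ≠ 0 ∧ hyp v = 0} =
      Nat.card {v // v ∈ singularReps m F ∧ φ v ≠ 0} * (Fintype.card F - 1) := by
  classical
  rw [← Fintype.card_units, ← Nat.card_eq_fintype_card, ← Nat.card_prod]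
  symm
  refine Nat.card_congr (Equiv.ofBijective
    (fun p => ⟨(p.2 : F) • p.1.1, ?_, ?_⟩) ⟨?_, ?_⟩)
  · rw [map_smul]; exact smul_ne_zero p.2.ne_zero p.1.2.2
  · rw [hyp_smul, hyp_of_mem_singularReps p.1.2.1, mul_zero]
  · rintro ⟨⟨v, hv, hv'⟩, c⟩ ⟨⟨w, hw, hw'⟩, b⟩ h
    have h1 : (c : F) • v = (b : F) • w := congrArg Subtype.val h
    have h2 : v = ((c⁻¹ * b : Fˣ) : F) • w := by
      rw [Units.val_mul, mul_smul, ← h1, smul_smul, Units.inv_mul, one_smul]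
    have h3 := eq_one_of_smul_mem_singularReps hw (h2 ▸ hv)
    rw [h3, one_smul] at h2
    have h4 : c = b := by
      have : c⁻¹ * b = 1 := Units.ext h3
      exact (inv_mul_eq_one.1 this)
    subst h2 h4
    rfl
  · rintro ⟨v, hv, hs⟩
    obtain ⟨c, hc, hmem⟩ := exists_smul_mem_singularReps hs (fun h => hv (by rw [h, map_zero]))
    refine ⟨(⟨c • v, hmem, ?_⟩, (Units.mk0 c hc)⁻¹), Subtype.ext ?_⟩
    · rw [map_smul]; exact smul_ne_zero hc hv
    · change c⁻¹ • c • v = v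
      rw [smul_smul, inv_mul_cancel₀ hc, one_smul]

theorem card_ne_zero_add_pow (φ : (Fin m ⊕ Fin m → F) →ₗ[F] K) :
    Nat.card {v // φ v ≠ 0} + Fintype.card F ^ (2 * m - Module.finrank F φ.range) =
      Fintype.card F ^ (2 * m) := by
  have h1 := φ.finrank_range_add_finrank_ker
  rw [Module.finrank_fintype_fun_eq_card, Fintype.card_sum, Fintype.card_fin, ← two_mul] at h1
  have h2 : Nat.card {v // φ v = 0} = Fintype.card F ^ (2 * m - Module.finrank F φ.range) := by
    have : 2 * m - Module.finrank F φ.range = Module.finrank F φ.ker := by omega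
    rw [this, ← Nat.card_eq_fintype_card, ← Module.natCard_eq_pow_finrank]
    rfl
  rw [← h2, add_comm, ← Nat.card_sum]
  classical
  rw [Nat.card_congr (Equiv.sumCompl fun v => φ v = 0)]
  simp [two_mul]

variable (F) in
-- The geometric sum telescopes; the additive form avoids truncated subtraction.
theorem card_mul_e_add_pow {r m : ℕ} (hr : r ≤ m) :
    e F r m * (Fintype.card F - 1) * Fintype.card F + Fintype.card F ^ (2 * m - r) =
      Fintype.card F ^ (2 * m) := by
  induction r with
  | zero => simp [e]
  | succ r ih =>
    rw [← ih (by omega)]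
    have h1 : e F (r + 1) m = e F r m + Fintype.card F ^ (2 * m - 1 - (r + 1)) := by
      rw [e, Finset.sum_Icc_succ_top (by omega)]; rfl
    obtain ⟨q, hq⟩ : ∃ q, Fintype.card F = q + 1 := ⟨_, (Nat.sub_add_cancel Fintype.card_pos).symm⟩
    obtain ⟨k, hk⟩ : ∃ k, 2 * m = k + r + 2 := ⟨2 * m - r - 2, by omega⟩
    have h2 : 2 * m - 1 - (r + 1) = k := by omega
    have h3 : 2 * m - (r + 1) = k + 1 := by omega
    have h4 : 2 * m - r = k + 2 := by omega
    rw [h1, h2, h3, h4, hq, Nat.add_sub_cancel]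
    ring

theorem card_reps_eq_e (φ : (Fin m ⊕ Fin m → F) →ₗ[F] K)
    (hr : Module.finrank F φ.range ≤ m)
    (h : ∀ z : K, z ≠ 0 → ∃ t, φ t = 0 ∧ hyp t = 0 ∧ ∀ v, φ v = z → polar v t ≠ 0) :
    Nat.card {v // v ∈ singularReps m F ∧ φ v ≠ 0} = e F (Module.finrank F φ.range) m := by
  have h1 := card_ne_zero_add_pow φ
  rw [card_ne_zero_eq_card_mul φ h, card_singular_eq_card_reps_mul, ← card_mul_e_add_pow F hr]
    at h1
  have hq : 1 < Fintype.card F := Fintype.one_lt_card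
  exact Nat.eq_of_mul_eq_mul_right (by omega)
    (Nat.eq_of_mul_eq_mul_right (by omega) (Nat.add_right_cancel h1))

end Counting

/-! ### Common zeros of the parameters -/

section Zeros

variable {m : ℕ} {F K : Type*} [Field F] [Fintype F] [Field K] [Algebra F K]

theorem aeval_linForm {F K : Type*} [Field F] [Field K] [Algebra F K]
    (w : Fin m ⊕ Fin m → K) (v : Fin m ⊕ Fin m → F) :
    aeval w (linForm v) = Fintype.linearCombination F w v := by
  rw [linForm, map_sum, Fintype.linearCombination_apply]
  exact Finset.sum_congr rfl fun k _ => by rw [map_mul, aeval_C, aeval_X, Algebra.smul_def]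

theorem polar_frobVec_zero_eq (w : Fin m ⊕ Fin m → K) {i : ℕ} (h : aeval w (xi m F i) = 0) :
    polar (frobVec F w 0) (frobVec F w i) = 0 := by
  have hw : frobVec F w 0 = w := by ext k; simp [frobVec]
  rw [polar_comm, hw]
  rcases eq_or_ne i 0 with rfl | hi
  · have := hyp_map ((aeval w : S m F →ₐ[F] K) : S m F →+* K) (X : Fin m ⊕ Fin m → S m F)
    rw [xi_zero] at h
    simp only [RingHom.coe_coe, aeval_X, h] at this
    rw [hw, polar_self]
    exact (congrArg _ this).trans (mul_zero _)
  · have := polar_map ((aeval w : S m F →ₐ[F] K) : S m F →+* K)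
      (fun k => X k ^ Fintype.card F ^ i) X
    rw [xi_of_ne_zero hi] at h
    simp only [RingHom.coe_coe, map_pow, aeval_X, h] at this
    exact this

theorem coeff_prod_one_add_card {κ R : Type*} [CommRing R] (s : Finset κ) (a : κ → R) :
    (∏ i ∈ s, (1 + Polynomial.C (a i) * Polynomial.X)).coeff s.card = ∏ i ∈ s, a i := by
  have := Polynomial.coeff_prod_of_natDegree_le s
    (fun i => 1 + Polynomial.C (a i) * Polynomial.X) 1 (fun i _ => by
      refine (Polynomial.natDegree_add_le _ _).trans ?_
      simpa using Polynomial.natDegree_C_mul_X_pow_le (a i) 1)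
  rw [mul_one] at this
  rw [this]
  exact Finset.prod_congr rfl fun i _ => by simp [Polynomial.coeff_one]

/-- At w the factors with v(w) = 0 become 1, and exactly e(r,m) factors remain, so the coefficient
in question is the product of the nonzero v(w)^{q-1}. -/
theorem aeval_d_finrank_ne_zero (hF : ringChar F ≠ 2) (hm : 1 ≤ m) {w : Fin m ⊕ Fin m → K}
    (h : ∀ i < m, aeval w (xi m F i) = 0) :
    aeval w (d m F (Module.finrank F (Fintype.linearCombination F w).range)) ≠ 0 := by
  classical
  have h := fun i hi => polar_frobVec_zero_eq w (h i hi)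
  set φ := Fintype.linearCombination F w with hφ
  obtain ⟨z, l, hz, hl⟩ := exists_rational_decomposition (F := F) w
  have hiso := polar_rational_eq_zero hF hm h hl
  -- The swap cancels the one in `polar`. So the kernel of φ is the orthogonal complement of the
  -- swapped rational vectors, which are again isotropic and hence lie in it; one of them serves as
  -- t.
  have hφl : ∀ v, φ v = ∑ a, polar v (fun k => l a k.swap) • z a := by
    intro v
    simp only [hφ, Fintype.linearCombination_apply, polar_apply, Sum.swap_swap, Finset.sum_smul]
    rw [Finset.sum_comm]
    refine Finset.sum_congr rfl fun k _ => ?_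
    conv_lhs => rw [hl, Finset.smul_sum]
    simp only [smul_smul]
  have hpolar : ∀ a b, polar (fun k => l a k.swap) (fun k => l b k.swap) = 0 := by
    intro a b
    rw [← hiso a b, polar_apply, polar_apply]
    exact Equiv.sum_comp (Equiv.sumComm (Fin m) (Fin m)) fun k => l a k * l b k.swap
  have hcard := card_reps_eq_e φ (finrank_range_le hF hm h) (by
    intro y hy
    by_cases hex : ∃ v, φ v = y
    · obtain ⟨v, rfl⟩ := hex
      obtain ⟨a, ha⟩ : ∃ a, polar v (fun k => l a k.swap) ≠ 0 := by
        by_contra! hall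
        exact hy (by rw [hφl]; simp [hall])
      refine ⟨fun k => l a k.swap, ?_, ?_, fun v' hv' h0 => ha ?_⟩
      · rw [hφl]; simp [hpolar]
      · have := hpolar a a
        rw [polar_self] at this
        exact (mul_eq_zero.1 this).resolve_left (Ring.two_ne_zero hF)
      · rw [hφl, hφl] at hv'
        -- Independence of `z` over F makes the pairings with the swapped vectors depend only on the
        -- value of φ, so one t works for the whole fibre.
        have := congrFun (hz.fintypeLinearCombination_injective
          (a₁ := fun a => polar v' fun k => l a k.swap) (a₂ := fun a => polar v fun k => l a k.swap)
          (by simpa only [Fintype.linearCombination_apply] using hv')) a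
        exact this.symm.trans h0
    · exact ⟨0, map_zero _, by simp [hyp], fun v hv => absurd ⟨v, hv⟩ hex⟩)
  have hcoeff : aeval w (d m F (Module.finrank F φ.range)) =
      ((chern m F).map ((aeval w : S m F →ₐ[F] K) : S m F →+* K)).coeff
        (e F (Module.finrank F φ.range) m) := by
    rw [d_eq_coeff_chern hF, Polynomial.coeff_map]; rfl
  have hmap : (chern m F).map ((aeval w : S m F →ₐ[F] K) : S m F →+* K) =
      ∏ v ∈ (singularReps m F).filter (fun v => φ v ≠ 0),
        (1 + Polynomial.C (φ v ^ (Fintype.card F - 1)) * Polynomial.X) := by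
    rw [chern, Polynomial.map_prod, Finset.prod_filter_of_ne]
    · refine Finset.prod_congr rfl fun v _ => ?_
      simp [aeval_linForm, hφ]
    · intro v _ hne h0
      have hq : Fintype.card F - 1 ≠ 0 := by
        have : 1 < Fintype.card F := Fintype.one_lt_card
        omega
      exact hne (by rw [h0, zero_pow hq]; simp)
  have hcard' : ((singularReps m F).filter (fun v => φ v ≠ 0)).card =
      e F (Module.finrank F φ.range) m := by
    rw [← hcard]
    exact (Nat.subtype_card _ fun v => Finset.mem_filter).symm
  rw [hcoeff, hmap, ← hcard', coeff_prod_one_add_card]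
  exact Finset.prod_ne_zero_iff.2 fun v hv => pow_ne_zero _ (Finset.mem_filter.1 hv).2

theorem eq_zero_of_aeval_H_eq_zero (hF : ringChar F ≠ 2) (hm : 1 ≤ m) {w : Fin m ⊕ Fin m → K}
    (h : ∀ i, aeval w (H m F i) = 0) : w = 0 := by
  have hxi : ∀ i < m, aeval w (xi m F i) = 0 := fun i hi => h (Sum.inl ⟨i, hi⟩)
  have hr := finrank_range_le hF hm fun i hi => polar_frobVec_zero_eq w (hxi i hi)
  have hd := aeval_d_finrank_ne_zero hF hm hxi
  obtain ⟨r, hr'⟩ : ∃ r, r = Module.finrank F (Fintype.linearCombination F w).range := ⟨_, rfl⟩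
  rw [← hr'] at hr hd
  cases r with
  | zero =>
    have h0 : Fintype.linearCombination F w = 0 := by
      rw [← LinearMap.range_eq_bot]
      exact Submodule.finrank_eq_zero.1 hr'.symm
    ext k
    have := LinearMap.congr_fun h0 (Pi.single k 1)
    simpa using this
  | succ r => exact absurd (h (Sum.inr ⟨r, hr⟩)) hd

theorem H_mem_invariants (hF : ringChar F ≠ 2) (i : Fin m ⊕ Fin m) :
    H m F i ∈ invariants (orthPlus m F) := by
  rcases i with i | i
  · exact xi_mem_invariants hF i
  · exact d_mem_invariants hF (i + 1)

theorem H_isHomogeneous (hF : ringChar F ≠ 2) (i : Fin m ⊕ Fin m) :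
    ∃ k : ℕ, 0 < k ∧ (H m F i).IsHomogeneous k := by
  rcases i with i | i
  · exact ⟨_, Nat.succ_pos _, xi_isHomogeneous i⟩
  · refine ⟨_, Nat.mul_pos ?_ ?_, d_isHomogeneous hF (i + 1)⟩
    · exact Finset.sum_pos (fun _ _ => pow_pos Fintype.card_pos _) (by simp)
    · have : 1 < Fintype.card F := Fintype.one_lt_card
      omega

end Zeros

end OrthInv

theorem theorem3p7 {F : Type*} [Field F] [Fintype F] (hF : ringChar F ≠ 2) (m : ℕ) (hm : 1 ≤ m) :
    OrthInv.IsHsop (OrthInv.invariants (OrthInv.orthPlus m F)) (OrthInv.H m F) :=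
  OrthInv.isHsop_of_forall_aeval_eq_zero (K := AlgebraicClosure F)
    (OrthInv.H_mem_invariants hF) (OrthInv.H_isHomogeneous hF)
    fun _ h => OrthInv.eq_zero_of_aeval_H_eq_zero hF hm h
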